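/- **Setting.** A game with stochastic rewards $x$ has $M\ge 1$ players with $N$ actions each, a probability distribution $r$ on a measurable space $\Theta$ of reward tensors, and utilities $u_i(a,\theta)\in[0,1]$ (measurable in $\theta$) for player $i$, action profile $a$ and $\theta\in\Theta$. In each round the players choose their actions simultaneously, $\theta$ is drawn from $r$ independently of everything else so far, and player $i$ observes only their own action and utility. A distribution $D$ over action profiles is an $\epsilon$-correlated equilibrium for $x$ if for all players $i$ and all swap functions $f:[N]\to[N]$, $$\mathbb E_{a\sim D,\theta\sim r}[u_i(a_i;a_{-i},\theta)]\ \ge\ \mathbb E_{a\sim D,\theta\sim r}[u_i(f(a_i);a_{-i},\theta)]-\epsilon .$$ A bandit algorithm $\mathcal B$ over $N$ actions chooses in each round a distribution over actions as a (measurable) function of its own earlier actions and the rewards it received for them. Its average swap regret after $T$ rounds with actions $a^t$ and reward vectors $b^t\in[0,1]^N$ is $\frac1T\big(\max_f\sum_{t\le T} b^t_{f(a^t)}-\sum_{t\le T} b^t_{a^t}\big)$, where $f$ ranges over all functions $[N]\to[N]$. Let $\mathcal B$ be any bandit algorithm. Write $B(\epsilon,N)$ for a positive number of rounds after which $\mathcal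 B$ has expected average swap regret at most $\epsilon$ against every adaptive adversary (who chooses $b^t$ knowing the past and the current distribution, but not $a^t$), and which is at least $2\,(N\log N+\log(2/\epsilon))/\epsilon^2$. The statement holds for every such number. **Statement.** Let $\epsilon,\eta>0$ and $0<\delta\le 1$, and let $T$ be an integer with $$T\ \ge\ \frac{2\log(5M/\delta)}{\eta^2}\cdot B(\epsilon/8,N).$$ Suppose that all players play $x$ for $T$ rounds according to private copies of $\mathcal B$, simultaneously restarting $\mathcal B$ every $B(\epsilon/8,N)$ rounds. Let $a^t,\theta^t$ be the profiles and tensors of the play, let $D$ be the uniform distribution over the sequence $a^1,\dots,a^T$, let $\hat V_i=\frac1T\sum_{t=1}^T u_i(a^t,\theta^t)$ be the average utility of player $i$, and let $V_i=\mathbb E[\hat V_i]$ (expectation over the algorithms and the tensors) be the value of the process for player $i$. 1. With probability at least $1-\delta/5$, $D$ is an $(\epsilon/2+\eta/2)$-correlated equilibrium for $x$. 2. With probability at least $1-2\delta/5$, $|V_i-\hat V_i|\le\eta/2$ simultaneously for all players $i$. If $T$ is a multiple of $B(\epsilon/8,N)$, then $V_i$ is also the expected average utility of player $i$ over a single run of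 $B(\epsilon/8,N)$ rounds of $\mathcal B$. 3. With probability at least $1-2\delta/5$, $\big|\hat V_i-\mathbb E_{a\sim D,\theta\sim r}[u_i(a,\theta)]\big|\le\eta$ simultaneously for all players $i$. -/

import Mathlib

open MeasureTheory

noncomputable section

/-- A bandit algorithm over the `N` actions `Fin N`. In round `t` (rounds are numbered from `0`) it
commits to a distribution over actions, which depends on what it has seen in the rounds before: its
own actions and the rewards of these actions (bandit feedback). -/
structure BanditAlgorithm (N : ℕ) where
  prob : (t : ℕ) → (Fin t → Fin N × ℝ) → Fin N → ℝ
  prob_nonneg : ∀ t h k, 0 ≤ prob t h k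
  prob_sum : ∀ t h, ∑ k, prob t h k = 1
  prob_measurable : ∀ t k, Measurable fun h => prob t h k

/-- An adaptive adversary: in round `t` it chooses a vector of rewards in `[0,1]` as an arbitrary
function of the actions drawn in the rounds before. Since the adversary may be chosen for a given
algorithm, it also knows the distribution to which the algorithm commits in round `t`, as this
is determined by the earlier actions and the earlier choices of the adversary. It does not see the
action drawn in round `t`. -/
structure Adversary (N : ℕ) where
  reward : (t : ℕ) → (Fin t → Fin N) → Fin N → ℝ
  reward_mem : ∀ t h k, reward t h k ∈ Set.Icc (0 : ℝ) 1

/-- The part of a finite sequence that precedes the index `t`. -/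
def before {α : Type*} {T : ℕ} (a : Fin T → α) (t : Fin T) : Fin t → α :=
  fun s => a ⟨s, s.2.trans t.2⟩

/-- The reward vector that the adversary chooses in round `t` when the actions are `a`. -/
def Adversary.vec {N T : ℕ} (adv : Adversary N) (a : Fin T → Fin N) (t : Fin T) : Fin N → ℝ :=
  adv.reward t (before a t)

/-- The probability that the algorithm draws the actions `a` in the first `T` rounds
against the adversary. -/
def BanditAlgorithm.seqProb {N : ℕ} (B : BanditAlgorithm N) (adv : Adversary N) {T : ℕ}
    (a : Fin T → Fin N) : ℝ :=
  ∏ t : Fin T, B.prob t (before (fun s => (a s, adv.vec a s (a s))) t) (a t)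

/-- The swap regret of the actions `a` on the reward vectors `b`. -/
def swapRegret {N T : ℕ} (a : Fin T → Fin N) (b : Fin T → Fin N → ℝ) : ℝ :=
  (⨆ f : Fin N → Fin N, ∑ t, b t (f (a t))) - ∑ t, b t (a t)

/-- The expected average swap regret of the algorithm after `T` rounds against the adversary. -/
def BanditAlgorithm.expAvgSwapRegret {N : ℕ} (B : BanditAlgorithm N) (adv : Adversary N)
    (T : ℕ) : ℝ :=
  (∑ a : Fin T → Fin N, B.seqProb adv a * swapRegret a (adv.vec a)) / T

/-- `L` rounds are a valid run length for the algorithm with `N` actions and accuracy `ε`: after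
`L` rounds its expected average swap regret is at most `ε` against every adaptive adversary, and `L`
is large enough for the reward tensors sampled in `L` rounds to be representative of their mean. -/
structure BanditAlgorithm.IsRunLength {N : ℕ} (B : BanditAlgorithm N) (ε : ℝ) (L : ℕ) : Prop where
  pos : 0 < L
  regret_le : ∀ adv : Adversary N, B.expAvgSwapRegret adv L ≤ ε
  sampling_le : 2 * (N * Real.log N + Real.log (2 / ε)) / ε ^ 2 ≤ L

/-- The algorithm that restarts `B` every `L` rounds: in round `t` it uses `B` with only the last
`t % L` rounds as history, that is, with those since the last restart. -/
def BanditAlgorithm.restart {N : ℕ} (B : BanditAlgorithm N) (L : ℕ) : BanditAlgorithm N where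
  prob t h := B.prob (t % L) fun s => h ⟨t - t % L + s, by
    have h1 := s.2
    have h2 := Nat.mod_le t L
    omega⟩
  prob_nonneg _ _ _ := B.prob_nonneg _ _ _
  prob_sum _ _ := B.prob_sum _ _
  prob_measurable t k := (B.prob_measurable (t % L) k).comp
    (measurable_pi_lambda _ fun _ => measurable_pi_apply _)

/-- A game with stochastic rewards, with `M` players who have `N` actions each. The reward
tensor `θ : Θ` is drawn from `r`, and `u a θ i` is the utility of player `i` under the action
profile `a`. -/
structure StochasticRewardGame (M N : ℕ) (Θ : Type*) [MeasurableSpace Θ] where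
  r : Measure Θ
  r_prob : IsProbabilityMeasure r
  u : (Fin M → Fin N) → Θ → Fin M → ℝ
  u_mem : ∀ a θ i, u a θ i ∈ Set.Icc (0 : ℝ) 1
  u_measurable : ∀ a i, Measurable fun θ => u a θ i

namespace StochasticRewardGame

variable {M N : ℕ} {Θ : Type*} [MeasurableSpace Θ]

/-- The expected utility of player `i` under the profile `a`. -/
def meanUtility (x : StochasticRewardGame M N Θ) (a : Fin M → Fin N) (i : Fin M) : ℝ :=
  ∫ θ, x.u a θ i ∂x.r

/-- The expected utility of player `i` when the profile is drawn from `D` and the reward tensor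
independently from `r`. -/
def expectedUtility (x : StochasticRewardGame M N Θ) (D : (Fin M → Fin N) → ℝ) (i : Fin M) : ℝ :=
  ∑ a, D a * x.meanUtility a i

/-- The same when player `i` replaces a recommended action by its image under `f`. -/
def swappedUtility (x : StochasticRewardGame M N Θ) (D : (Fin M → Fin N) → ℝ) (i : Fin M)
    (f : Fin N → Fin N) : ℝ :=
  ∑ a, D a * x.meanUtility (Function.update a i (f (a i))) i

/-- `D` is an `ε`-correlated equilibrium: a probability distribution over action profiles from
which no player gains more than `ε` in expectation by a swap function. -/
def IsApproxCE (x : StochasticRewardGame M N Θ) (ε : ℝ) (D : (Fin M → Fin N) → ℝ) : Prop :=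
  D ∈ stdSimplex ℝ (Fin M → Fin N) ∧
    ∀ (i : Fin M) (f : Fin N → Fin N), x.expectedUtility D i ≥ x.swappedUtility D i f - ε

/-- What player `i` observes in a play with profiles `a` and reward tensors `θ`: in every round,
their own action and their own utility. -/
def observed (x : StochasticRewardGame M N Θ) {T : ℕ} (a : Fin T → Fin M → Fin N) (θ : Fin T → Θ)
    (i : Fin M) : Fin T → Fin N × ℝ :=
  fun t => (a t i, x.u (a t) (θ t) i)

/-- The law of `T` rounds of play (the action profiles and the reward tensors) when every player
uses a private copy of `B`. The reward tensors are independent draws from `r`. Given the past, the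
players draw their actions independently of each other and of the current tensor, each
from the distribution that `B` assigns to what this player observed. So the law has the density
below with respect to the product of the counting measure and a power of `r`. -/
def playLaw (x : StochasticRewardGame M N Θ) (B : BanditAlgorithm N) (T : ℕ) :
    Measure ((Fin T → Fin M → Fin N) × (Fin T → Θ)) :=
  (Measure.count.prod (Measure.pi fun _ : Fin T => x.r)).withDensity fun ω =>
    ENNReal.ofReal
      (∏ t : Fin T, ∏ i : Fin M, B.prob t (before (x.observed ω.1 ω.2 i) t) (ω.1 t i))

/-- The average utility that player `i` receives in a play. -/
def avgUtility (x : StochasticRewardGame M N Θ) {T : ℕ}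
    (ω : (Fin T → Fin M → Fin N) × (Fin T → Θ)) (i : Fin M) : ℝ :=
  (∑ t, x.u (ω.1 t) (ω.2 t) i) / T

/-- The value for player `i` of the process in which all players use `B` for `T` rounds: the
expectation of the average utility. -/
def processValue (x : StochasticRewardGame M N Θ) (B : BanditAlgorithm N) (T : ℕ) (i : Fin M) : ℝ :=
  ∫ ω, x.avgUtility ω i ∂x.playLaw B T

end StochasticRewardGame

/-- The uniform distribution over a finite sequence of action profiles. -/
def empirical {M N T : ℕ} (a : Fin T → Fin M → Fin N) : (Fin M → Fin N) → ℝ :=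
  fun p => (Finset.univ.filter fun t => a t = p).card / T

end

/-! Write `L` for the run length and `ε'` for `ε / 8`. A restart erases the memory of every player,
so the law of `L + n` rounds is the product of the law of one run and the law of `n` restarted
rounds (`measurePreserving_appendPlay`). A functional that is subadditive over blocks and has range
`n` on a block of `n ≤ L` rounds therefore has a moment generating function bounded by a product
over blocks. Hoeffding's lemma on each block gives `exp (l e + L T l² / 8)` (`mgf_restart_le`), and
Chernoff's bound at deviation `T η / 2` gives `exp (-T η² / (2 L)) ≤ δ / (5 M)`. Union bounds over
`M` or `2 M` tails finish each claim.

Equilibrium: the functional is `meanRegret`, the best swap gain measured in mean utilities, since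
the empirical distribution is a `c`-correlated equilibrium once this is at most `T c` for every
player. On a block its expectation is at most `2 L ε'`, with two contributions. The realized swap
regret costs `L ε'`: for fixed tensors the other players form a randomized adaptive adversary, and
some deterministic adversary does at least as well (`exists_adversary_sum_playDensity_le`).
Replacing realized by mean utilities costs another `L ε'`: for each of the `N ^ N` swap functions
the error is a martingale, and the expected maximum is controlled by `N log N`, which the sampling
condition on `L` absorbs. Rounding the number of blocks up costs at most a factor `2`, whence `T ε /
2`.

Value: sums of utilities are additive over blocks, so the same block argument applies to them with
their exact means and both signs.

Expected utility under the empirical distribution: actions are drawn before the tensor, so utility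
minus mean utility is a martingale difference for any algorithm, restarted or not. -/

noncomputable section

/-! ### Extending and concatenating finite sequences -/

section Sequences

variable {α β : Type*} {m n : ℕ}

theorem before_snoc_castSucc (a : Fin n → α) (k : α) (t : Fin n) :
    before (Fin.snoc a k : Fin (n + 1) → α) t.castSucc = before a t := by
  funext s
  have hs : (s : ℕ) < n := lt_trans s.2 t.2
  exact Fin.snoc_castSucc (α := fun _ => α) k a ⟨s, hs⟩

theorem before_snoc_last (a : Fin n → α) (k : α) :
    before (Fin.snoc a k : Fin (n + 1) → α) (Fin.last n) = a := by
  funext s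
  exact Fin.snoc_castSucc (α := fun _ => α) k a s

theorem before_cons_succ (a : Fin n → α) (k : α) (t : Fin n) :
    before (Fin.cons k a : Fin (n + 1) → α) t.succ = Fin.cons k (before a t) := by
  funext s
  refine Fin.cases ?_ (fun s => ?_) s
  · rfl
  · rfl

theorem before_append_castAdd (a : Fin m → α) (b : Fin n → α) (t : Fin m) :
    before (Fin.append a b) (t.castAdd n) = before a t := by
  funext s
  exact Fin.append_left a b ⟨s, lt_trans s.2 t.2⟩

theorem sum_snoc [Fintype α] [AddCommMonoid β] (F : (Fin (n + 1) → α) → β) :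
    ∑ a, F a = ∑ a : Fin n → α, ∑ k, F (Fin.snoc a k) := by
  rw [← (Fin.snocEquiv fun _ => α).sum_comp, Fintype.sum_prod_type, Finset.sum_comm]
  rfl

theorem sum_cons [Fintype α] [AddCommMonoid β] (F : (Fin (n + 1) → α) → β) :
    ∑ a, F a = ∑ k, ∑ a : Fin n → α, F (Fin.cons k a) := by
  rw [← (Fin.consEquiv fun _ => α).sum_comp, Fintype.sum_prod_type]
  rfl

theorem sum_append [Fintype α] [AddCommMonoid β] (F : (Fin (m + n) → α) → β) :
    ∑ a, F a = ∑ a : Fin m → α, ∑ b : Fin n → α, F (Fin.append a b) := by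
  rw [← (Fin.appendEquiv (α := α) m n).sum_comp, Fintype.sum_prod_type]
  rfl

variable [MeasurableSpace α]

theorem measurable_finAppend :
    Measurable fun p : (Fin m → α) × (Fin n → α) => Fin.append p.1 p.2 := by
  refine measurable_pi_lambda _ fun t => ?_
  refine Fin.addCases (fun t => ?_) (fun t => ?_) t
  · simp only [Fin.append_left]
    exact (measurable_pi_apply t).comp measurable_fst
  · simp only [Fin.append_right]
    exact (measurable_pi_apply t).comp measurable_snd

theorem measurable_finSnoc :
    Measurable fun p : (Fin n → α) × α => (Fin.snoc p.1 p.2 : Fin (n + 1) → α) := by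
  refine measurable_pi_lambda _ fun t => ?_
  refine Fin.lastCases ?_ (fun t => ?_) t
  · simp only [Fin.snoc_last]
    exact measurable_snd
  · simp only [Fin.snoc_castSucc]
    exact (measurable_pi_apply t).comp measurable_fst

theorem measurePreserving_finAppend (r : Measure α) [SigmaFinite r] :
    MeasurePreserving (fun p : (Fin m → α) × (Fin n → α) => Fin.append p.1 p.2)
      ((Measure.pi fun _ => r).prod (Measure.pi fun _ => r)) (Measure.pi fun _ => r) := by
  refine ⟨measurable_finAppend, (Measure.pi_eq fun s hs => ?_).symm⟩
  rw [Measure.map_apply measurable_finAppend (MeasurableSet.univ_pi hs), Fin.prod_univ_add,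
    ← Measure.pi_pi, ← Measure.pi_pi, ← Measure.prod_prod]
  congr 1
  ext p
  simp only [Set.mem_preimage, Set.mem_pi, Set.mem_univ, true_imp_iff, Set.mem_prod]
  refine ⟨fun h => ⟨fun t => ?_, fun t => ?_⟩, fun h t => ?_⟩
  · simpa using h (t.castAdd n)
  · simpa using h (t.natAdd m)
  · refine Fin.addCases (fun t => ?_) (fun t => ?_) t
    · simpa using h.1 t
    · simpa using h.2 t

theorem measurePreserving_finSnoc (r : Measure α) [SigmaFinite r] :
    MeasurePreserving (fun p : (Fin n → α) × α => (Fin.snoc p.1 p.2 : Fin (n + 1) → α))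
      ((Measure.pi fun _ => r).prod r) (Measure.pi fun _ => r) := by
  refine ⟨measurable_finSnoc, (Measure.pi_eq fun s hs => ?_).symm⟩
  rw [Measure.map_apply measurable_finSnoc (MeasurableSet.univ_pi hs), Fin.prod_univ_castSucc,
    ← Measure.pi_pi, ← Measure.prod_prod]
  congr 1
  ext p
  simp only [Set.mem_preimage, Set.mem_pi, Set.mem_univ, true_imp_iff, Set.mem_prod]
  refine ⟨fun h => ⟨fun t => ?_, ?_⟩, fun h t => ?_⟩
  · simpa using h t.castSucc
  · simpa using h (Fin.last n)
  · refine Fin.lastCases ?_ (fun t => ?_) t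
    · simpa using h.2
    · simpa using h.1 t

end Sequences

/-! ### The restarted algorithm -/

namespace BanditAlgorithm

variable {N : ℕ}

/-- Histories of lengths such as `(L + t) % L` and `t % L` have different types, so they are
compared entry by entry. -/
theorem prob_congr (B : BanditAlgorithm N) {s t : ℕ} (hst : s = t) (g : Fin s → Fin N × ℝ)
    (h : Fin t → Fin N × ℝ) (hgh : ∀ j (hs : j < s) (ht : j < t), g ⟨j, hs⟩ = h ⟨j, ht⟩) :
    B.prob s g = B.prob t h := by
  subst hst
  congr 1
  funext j
  exact hgh j j.2 j.2

theorem restart_prob_of_lt (B : BanditAlgorithm N) {L t : ℕ} (ht : t < L)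
    (h : Fin t → Fin N × ℝ) : (B.restart L).prob t h = B.prob t h := by
  refine B.prob_congr (Nat.mod_eq_of_lt ht) _ _ fun j hs ht' => ?_
  congr 2
  simp [Nat.mod_eq_of_lt ht]

/-- The last restart before round `L + t` lies at or after round `L`, so the history in use is
contained in the second part and `g` is forgotten. -/
theorem restart_prob_append (B : BanditAlgorithm N) {L n : ℕ} (g : Fin L → Fin N × ℝ)
    (h : Fin n → Fin N × ℝ) (t : Fin n) :
    (B.restart L).prob (L + t) (before (Fin.append g h) (t.natAdd L)) =
      (B.restart L).prob t (before h t) := by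
  have hmod : (L + (t : ℕ)) % L = t % L := Nat.add_mod_left L t
  refine B.prob_congr hmod _ _ fun j hs ht' => ?_
  have h2 := Nat.mod_le (t : ℕ) L
  have h3 := t.2
  have key : (⟨L + t - (L + t) % L + j, by omega⟩ : Fin (L + n)) =
      Fin.natAdd L ⟨t - t % L + j, by omega⟩ := by
    ext
    simp only [Fin.natAdd_mk]
    omega
  change Fin.append g h ⟨L + t - (L + t) % L + j, _⟩ = h ⟨t - t % L + j, _⟩
  rw [key, Fin.append_right]

end BanditAlgorithm

/-! ### The law of play and its factorization at restarts -/

namespace StochasticRewardGame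

variable {M N : ℕ} {Θ : Type*} [MeasurableSpace Θ] (x : StochasticRewardGame M N Θ)

instance : IsProbabilityMeasure x.r := x.r_prob

/-- The probability of the profiles `a` given the reward tensors `θ` when player `i` uses the
algorithm `B i`. -/
def playDensity (B : Fin M → BanditAlgorithm N) {T : ℕ} (a : Fin T → Fin M → Fin N)
    (θ : Fin T → Θ) : ℝ :=
  ∏ t : Fin T, ∏ i : Fin M, (B i).prob t (before (x.observed a θ i) t) (a t i)

variable {x}

theorem playDensity_nonneg (B : Fin M → BanditAlgorithm N) {T : ℕ} (a : Fin T → Fin M → Fin N)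
    (θ : Fin T → Θ) : 0 ≤ x.playDensity B a θ :=
  Finset.prod_nonneg fun _ _ => Finset.prod_nonneg fun i _ => (B i).prob_nonneg _ _ _

theorem measurable_playDensity (B : Fin M → BanditAlgorithm N) {T : ℕ}
    (a : Fin T → Fin M → Fin N) : Measurable (x.playDensity B a) := by
  refine Finset.measurable_prod _ fun t _ => Finset.measurable_prod _ fun i _ => ?_
  refine ((B i).prob_measurable _ _).comp (measurable_pi_lambda _ fun s => ?_)
  exact measurable_const.prodMk ((x.u_measurable _ i).comp (measurable_pi_apply _))

theorem observed_snoc {n : ℕ} (a : Fin n → Fin M → Fin N) (p : Fin M → Fin N) (θ : Fin n → Θ)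
    (θ' : Θ) (i : Fin M) :
    x.observed (Fin.snoc a p : Fin (n + 1) → Fin M → Fin N) (Fin.snoc θ θ') i =
      Fin.snoc (x.observed a θ i) (p i, x.u p θ' i) := by
  funext t
  refine Fin.lastCases ?_ (fun t => ?_) t <;> simp [observed]

theorem observed_cons {n : ℕ} (a : Fin n → Fin M → Fin N) (p : Fin M → Fin N) (θ : Fin n → Θ)
    (θ' : Θ) (i : Fin M) :
    x.observed (Fin.cons p a : Fin (n + 1) → Fin M → Fin N) (Fin.cons θ' θ) i =
      Fin.cons (p i, x.u p θ' i) (x.observed a θ i) := by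
  funext t
  refine Fin.cases ?_ (fun t => ?_) t <;> simp [observed]

theorem observed_append {m n : ℕ} (a : Fin m → Fin M → Fin N) (b : Fin n → Fin M → Fin N)
    (θ : Fin m → Θ) (θ' : Fin n → Θ) (i : Fin M) :
    x.observed (Fin.append a b) (Fin.append θ θ') i =
      Fin.append (x.observed a θ i) (x.observed b θ' i) := by
  funext t
  refine Fin.addCases (fun t => ?_) (fun t => ?_) t <;> simp [observed]

theorem playDensity_snoc (B : Fin M → BanditAlgorithm N) {n : ℕ} (a : Fin n → Fin M → Fin N)
    (p : Fin M → Fin N) (θ : Fin n → Θ) (θ' : Θ) :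
    x.playDensity B (Fin.snoc a p : Fin (n + 1) → Fin M → Fin N) (Fin.snoc θ θ') =
      x.playDensity B a θ * ∏ i, (B i).prob n (x.observed a θ i) (p i) := by
  simp only [playDensity, Fin.prod_univ_castSucc, observed_snoc, before_snoc_castSucc,
    before_snoc_last, Fin.snoc_castSucc, Fin.snoc_last]
  rfl

theorem playDensity_restart_append (B : BanditAlgorithm N) {L n : ℕ}
    (a : Fin L → Fin M → Fin N) (b : Fin n → Fin M → Fin N) (θ : Fin L → Θ) (θ' : Fin n → Θ) :
    x.playDensity (fun _ => B.restart L) (Fin.append a b) (Fin.append θ θ') =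
      x.playDensity (fun _ => B) a θ * x.playDensity (fun _ => B.restart L) b θ' := by
  simp only [playDensity, Fin.prod_univ_add, observed_append, before_append_castAdd,
    Fin.append_left, Fin.append_right]
  congr 1
  · refine Finset.prod_congr rfl fun t _ => Finset.prod_congr rfl fun i _ => ?_
    exact congrFun (B.restart_prob_of_lt t.2 _) _
  · refine Finset.prod_congr rfl fun t _ => Finset.prod_congr rfl fun i _ => ?_
    exact congrFun (B.restart_prob_append _ _ t) _

theorem playLaw_restart_of_le (x : StochasticRewardGame M N Θ) (B : BanditAlgorithm N)
    {L n : ℕ} (h : n ≤ L) : x.playLaw (B.restart L) n = x.playLaw B n := by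
  unfold playLaw
  congr 1
  funext ω
  congr 1
  refine Finset.prod_congr rfl fun t _ => Finset.prod_congr rfl fun i _ => ?_
  exact congrFun (B.restart_prob_of_lt (t.2.trans_le h) _) _

theorem sum_prod_prob (B : Fin M → BanditAlgorithm N) {n : ℕ} (h : Fin M → Fin n → Fin N × ℝ) :
    ∑ p : Fin M → Fin N, ∏ i, (B i).prob n (h i) (p i) = 1 := by
  rw [← Fintype.prod_sum (fun i k => (B i).prob n (h i) k)]
  simp [BanditAlgorithm.prob_sum]

/-- Having the tensors outside and the finite sum over profiles inside allows arguments for each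
fixed sequence of tensors. -/
theorem lintegral_playLaw (x : StochasticRewardGame M N Θ) (B : BanditAlgorithm N) {T : ℕ}
    {F : (Fin T → Fin M → Fin N) × (Fin T → Θ) → ENNReal} (hF : Measurable F) :
    ∫⁻ ω, F ω ∂x.playLaw B T = ∫⁻ θ, ∑ a, ENNReal.ofReal (x.playDensity (fun _ => B) a θ) *
      F (a, θ) ∂Measure.pi fun _ : Fin T => x.r := by
  have hd : Measurable fun ω : (Fin T → Fin M → Fin N) × (Fin T → Θ) =>
      ENNReal.ofReal (x.playDensity (fun _ => B) ω.1 ω.2) :=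
    (measurable_from_prod_countable_right
      (f := fun ω : (Fin T → Fin M → Fin N) × (Fin T → Θ) => x.playDensity (fun _ => B) ω.1 ω.2)
      fun a => measurable_playDensity _ a).ennreal_ofReal
  let g : (Fin T → Fin M → Fin N) × (Fin T → Θ) → ENNReal := fun ω =>
    ENNReal.ofReal (x.playDensity (fun _ => B) ω.1 ω.2) * F ω
  have hg : Measurable g := hd.mul hF
  calc ∫⁻ ω, F ω ∂x.playLaw B T
      = ∫⁻ ω, g ω ∂(Measure.count.prod (Measure.pi fun _ : Fin T => x.r)) :=
        lintegral_withDensity_eq_lintegral_mul _ hd hF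
    _ = ∫⁻ a, ∫⁻ θ, g (a, θ) ∂(Measure.pi fun _ : Fin T => x.r) ∂Measure.count :=
        lintegral_prod g hg.aemeasurable
    _ = ∑ a, ∫⁻ θ, g (a, θ) ∂(Measure.pi fun _ : Fin T => x.r) := by
        rw [lintegral_count, tsum_fintype]
    _ = ∫⁻ θ, ∑ a, g (a, θ) ∂(Measure.pi fun _ : Fin T => x.r) :=
        (lintegral_finsetSum _ fun a _ => hg.comp measurable_prodMk_left).symm

/-- Disintegration over the last round: the profile is drawn given the past, the tensor
independently of both. This replaces conditional expectations in inductions over rounds. -/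
theorem lintegral_playLaw_snoc (x : StochasticRewardGame M N Θ) (B : BanditAlgorithm N) {n : ℕ}
    {F : (Fin (n + 1) → Fin M → Fin N) × (Fin (n + 1) → Θ) → ENNReal} (hF : Measurable F) :
    ∫⁻ ω, F ω ∂x.playLaw B (n + 1) = ∫⁻ ω, ∑ p : Fin M → Fin N,
      ENNReal.ofReal (∏ i, B.prob n (x.observed ω.1 ω.2 i) (p i)) *
        ∫⁻ θ', F (Fin.snoc ω.1 p, Fin.snoc ω.2 θ') ∂x.r ∂x.playLaw B n := by
  have hw (p : Fin M → Fin N) : Measurable fun ω : (Fin n → Fin M → Fin N) × (Fin n → Θ) =>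
      ENNReal.ofReal (∏ i, B.prob n (x.observed ω.1 ω.2 i) (p i)) := by
    refine (measurable_from_prod_countable_right fun a => ?_).ennreal_ofReal
    refine Finset.measurable_prod _ fun i _ => (B.prob_measurable _ _).comp
      (measurable_pi_lambda _ fun s => ?_)
    exact measurable_const.prodMk ((x.u_measurable _ i).comp (measurable_pi_apply _))
  have hFs (a : Fin n → Fin M → Fin N) (p : Fin M → Fin N) :
      Measurable fun q : (Fin n → Θ) × Θ => F (Fin.snoc a p, Fin.snoc q.1 q.2) :=
    hF.comp (measurable_const.prodMk measurable_finSnoc)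
  have hG : Measurable fun ω : (Fin n → Fin M → Fin N) × (Fin n → Θ) => ∑ p : Fin M → Fin N,
      ENNReal.ofReal (∏ i, B.prob n (x.observed ω.1 ω.2 i) (p i)) *
        ∫⁻ θ', F (Fin.snoc ω.1 p, Fin.snoc ω.2 θ') ∂x.r := by
    refine Finset.measurable_sum _ fun p _ => (hw p).mul ?_
    exact measurable_from_prod_countable_right fun a => (hFs a p).lintegral_prod_right'
  have hd (a : Fin (n + 1) → Fin M → Fin N) : Measurable fun θ =>
      ENNReal.ofReal (x.playDensity (fun _ => B) a θ) * F (a, θ) :=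
    (measurable_playDensity _ a).ennreal_ofReal.mul (hF.comp measurable_prodMk_left)
  have hs := Finset.measurable_sum Finset.univ fun a _ => hd a
  rw [lintegral_playLaw x B hF, lintegral_playLaw x B hG,
    ← (measurePreserving_finSnoc x.r).lintegral_comp hs]
  refine (lintegral_prod _ (hs.comp measurable_finSnoc).aemeasurable).trans ?_
  refine lintegral_congr fun θ => ?_
  refine (lintegral_finsetSum _
    fun a _ => ((hd a).comp measurable_finSnoc).comp measurable_prodMk_left).trans ?_
  rw [sum_snoc]
  refine Finset.sum_congr rfl fun a _ => ?_
  rw [Finset.mul_sum]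
  refine Finset.sum_congr rfl fun p _ => ?_
  rw [← mul_assoc, ← ENNReal.ofReal_mul (playDensity_nonneg _ _ _)]
  refine Eq.trans ?_ (lintegral_const_mul _ ((hFs a p).comp measurable_prodMk_left))
  refine lintegral_congr fun θ' => ?_
  simp only [Function.comp_apply, playDensity_snoc]

instance isProbabilityMeasure_playLaw (x : StochasticRewardGame M N Θ) (B : BanditAlgorithm N)
    (T : ℕ) : IsProbabilityMeasure (x.playLaw B T) := by
  constructor
  rw [← lintegral_one]
  induction T with
  | zero =>
    rw [lintegral_playLaw x B measurable_const]
    simp [playDensity]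
  | succ n ih =>
    rw [lintegral_playLaw_snoc x B measurable_const]
    refine (lintegral_congr fun ω => ?_).trans ih
    simp only [lintegral_one, measure_univ, mul_one]
    rw [← ENNReal.ofReal_sum_of_nonneg
      fun p _ => Finset.prod_nonneg fun i _ => B.prob_nonneg _ _ _,
      sum_prod_prob (fun _ => B) (fun i => x.observed ω.1 ω.2 i), ENNReal.ofReal_one]

/-- The play that consists of a play of `m` rounds followed by one of `n` rounds. -/
def appendPlay {m n : ℕ} (p : ((Fin m → Fin M → Fin N) × (Fin m → Θ)) ×
    ((Fin n → Fin M → Fin N) × (Fin n → Θ))) :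
    (Fin (m + n) → Fin M → Fin N) × (Fin (m + n) → Θ) :=
  (Fin.append p.1.1 p.2.1, Fin.append p.1.2 p.2.2)

theorem measurable_appendPlay {m n : ℕ} :
    Measurable (appendPlay (M := M) (N := N) (Θ := Θ) (m := m) (n := n)) :=
  (measurable_finAppend.comp
    ((measurable_fst.comp measurable_fst).prodMk (measurable_fst.comp measurable_snd))).prodMk
  (measurable_finAppend.comp
    ((measurable_snd.comp measurable_fst).prodMk (measurable_snd.comp measurable_snd)))

/-- The rounds after the first restart are independent of the rounds before. -/
theorem measurePreserving_appendPlay (x : StochasticRewardGame M N Θ) (B : BanditAlgorithm N)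
    (L n : ℕ) :
    MeasurePreserving appendPlay ((x.playLaw B L).prod (x.playLaw (B.restart L) n))
      (x.playLaw (B.restart L) (L + n)) := by
  refine ⟨measurable_appendPlay, Measure.ext_of_lintegral _ fun F hF => ?_⟩
  have hFa := hF.comp (measurable_appendPlay (M := M) (N := N) (Θ := Θ) (m := L) (n := n))
  have hd (a : Fin (L + n) → Fin M → Fin N) : Measurable fun θ =>
      ENNReal.ofReal (x.playDensity (fun _ => B.restart L) a θ) * F (a, θ) :=
    (measurable_playDensity _ a).ennreal_ofReal.mul (hF.comp measurable_prodMk_left)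
  have hs := Finset.measurable_sum Finset.univ fun a _ => hd a
  rw [lintegral_map hF measurable_appendPlay]
  refine (lintegral_prod _ hFa.aemeasurable).trans ?_
  -- Both sides become integrals over tensors of sums over profiles; they agree because the density
  -- of the long play factors pointwise.
  rw [lintegral_playLaw x B hFa.lintegral_prod_right', lintegral_playLaw x _ hF,
    ← (measurePreserving_finAppend x.r).lintegral_comp hs]
  refine Eq.trans ?_ (lintegral_prod _ (hs.comp measurable_finAppend).aemeasurable).symm
  refine lintegral_congr fun θ => ?_
  refine Eq.trans ?_ (lintegral_finsetSum _ fun a _ => ((hd a).comp measurable_finAppend).comp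
    measurable_prodMk_left).symm
  rw [sum_append]
  refine Finset.sum_congr rfl fun a _ => ?_
  have hFb := hFa.comp (measurable_prodMk_left (x := (a, θ)))
  have hdb (b : Fin n → Fin M → Fin N) : Measurable fun θ' =>
      ENNReal.ofReal (x.playDensity (fun _ => B.restart L) b θ') *
        ((F ∘ appendPlay) ∘ Prod.mk (a, θ)) (b, θ') :=
    (measurable_playDensity _ b).ennreal_ofReal.mul (hFb.comp measurable_prodMk_left)
  refine (congrArg _ (lintegral_playLaw x _ hFb)).trans ?_
  rw [lintegral_finsetSum _ fun b _ => hdb b, Finset.mul_sum]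
  refine Finset.sum_congr rfl fun b _ => ?_
  rw [← lintegral_const_mul _ (hdb b)]
  refine lintegral_congr fun θ' => ?_
  simp only [Function.comp_apply]
  rw [playDensity_restart_append, ENNReal.ofReal_mul (playDensity_nonneg _ _ _), mul_assoc]
  rfl

end StochasticRewardGame

/-! ### Adversaries and the regret of partial runs -/

namespace BanditAlgorithm

variable {N : ℕ}

theorem prob_zero_eq (B : BanditAlgorithm N) (g h : Fin 0 → Fin N × ℝ) :
    B.prob 0 g = B.prob 0 h :=
  congrArg _ (Subsingleton.elim _ _)

/-- The algorithm in the rounds after a first round in which `o` was observed. -/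
def shift (B : BanditAlgorithm N) (o : Fin N × ℝ) : BanditAlgorithm N where
  prob t h := B.prob (t + 1) (Fin.cons o h)
  prob_nonneg _ _ _ := B.prob_nonneg _ _ _
  prob_sum _ _ := B.prob_sum _ _
  prob_measurable t k := (B.prob_measurable (t + 1) k).comp <| measurable_pi_lambda _ fun s => by
    refine Fin.cases ?_ (fun s => ?_) s
    · simp only [Fin.cons_zero]
      exact measurable_const
    · simp only [Fin.cons_succ]
      exact measurable_pi_apply s

end BanditAlgorithm

namespace Adversary

variable {N : ℕ}

/-- The adversary that never gives a reward. -/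
def zero (N : ℕ) : Adversary N where
  reward _ _ _ := 0
  reward_mem _ _ _ := by simp

/-- The adversary that chooses `b` in the first round and then plays like `adv k`, where `k` is
the action drawn in the first round. -/
def cons (b : Fin N → ℝ) (hb : ∀ k, b k ∈ Set.Icc (0 : ℝ) 1) (adv : Fin N → Adversary N) :
    Adversary N where
  reward
    | 0, _ => b
    | t + 1, h => (adv (h 0)).reward t (Fin.tail h)
  reward_mem
    | 0, _, k => hb k
    | _ + 1, _, _ => (adv _).reward_mem _ _ _

/-- The adversary that gives no rewards from round `n` on. -/
def truncate (adv : Adversary N) (n : ℕ) : Adversary N where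
  reward t h k := if t < n then adv.reward t h k else 0
  reward_mem t h k := by
    split_ifs
    · exact adv.reward_mem t h k
    · simp

theorem vec_cons (b : Fin N → ℝ) (hb : ∀ k, b k ∈ Set.Icc (0 : ℝ) 1) (adv : Fin N → Adversary N)
    {n : ℕ} (k : Fin N) (a : Fin n → Fin N) :
    (cons b hb adv).vec (Fin.cons k a : Fin (n + 1) → Fin N) = Fin.cons b ((adv k).vec a) := by
  funext t
  refine Fin.cases ?_ (fun t => ?_) t
  · rfl
  · simp only [vec, before_cons_succ, Fin.cons_succ]
    rfl

theorem vec_snoc (adv : Adversary N) {n : ℕ} (a : Fin n → Fin N) (k : Fin N) :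
    adv.vec (Fin.snoc a k : Fin (n + 1) → Fin N) = Fin.snoc (adv.vec a) (adv.reward n a) := by
  funext t
  refine Fin.lastCases ?_ (fun t => ?_) t
  · simp only [vec, before_snoc_last, Fin.snoc_last]
    rfl
  · simp only [vec, before_snoc_castSucc, Fin.snoc_castSucc]
    rfl

end Adversary

namespace BanditAlgorithm

variable {N : ℕ}

theorem seqProb_cons (B : BanditAlgorithm N) (b : Fin N → ℝ) (hb : ∀ k, b k ∈ Set.Icc (0 : ℝ) 1)
    (adv : Fin N → Adversary N) {n : ℕ} (k : Fin N) (a : Fin n → Fin N) :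
    B.seqProb (Adversary.cons b hb adv) (Fin.cons k a : Fin (n + 1) → Fin N) =
      B.prob 0 Fin.elim0 k * (B.shift (k, b k)).seqProb (adv k) a := by
  have h : (fun s : Fin (n + 1) => ((Fin.cons k a : Fin (n + 1) → Fin N) s,
      (Adversary.cons b hb adv).vec (Fin.cons k a : Fin (n + 1) → Fin N) s
        ((Fin.cons k a : Fin (n + 1) → Fin N) s))) =
      Fin.cons (k, b k) (fun s => (a s, (adv k).vec a s (a s))) := by
    funext s
    rw [Adversary.vec_cons]
    refine Fin.cases ?_ (fun s => ?_) s <;> simp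
  simp only [seqProb, h, Fin.prod_univ_succ, before_cons_succ, Fin.cons_zero, Fin.cons_succ]
  congr 1
  exact congrFun (B.prob_zero_eq _ _) _

theorem seqProb_snoc (B : BanditAlgorithm N) (adv : Adversary N) {n : ℕ} (a : Fin n → Fin N)
    (k : Fin N) :
    B.seqProb adv (Fin.snoc a k : Fin (n + 1) → Fin N) =
      B.seqProb adv a * B.prob n (fun s => (a s, adv.vec a s (a s))) k := by
  have h : (fun s : Fin (n + 1) => ((Fin.snoc a k : Fin (n + 1) → Fin N) s,
      adv.vec (Fin.snoc a k : Fin (n + 1) → Fin N) s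
        ((Fin.snoc a k : Fin (n + 1) → Fin N) s))) =
      Fin.snoc (fun s => (a s, adv.vec a s (a s))) (k, adv.reward n a k) := by
    funext s
    rw [Adversary.vec_snoc]
    refine Fin.lastCases ?_ (fun s => ?_) s <;> simp
  simp only [seqProb, h, Fin.prod_univ_castSucc, before_snoc_castSucc, before_snoc_last,
    Fin.snoc_castSucc, Fin.snoc_last]
  rfl

theorem vec_truncate (adv : Adversary N) {n m : ℕ} (h : m ≤ n) (a : Fin m → Fin N) :
    (adv.truncate n).vec a = adv.vec a := by
  funext t k
  exact if_pos (t.2.trans_le h)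

theorem seqProb_truncate (B : BanditAlgorithm N) (adv : Adversary N) {n m : ℕ} (h : m ≤ n)
    (a : Fin m → Fin N) : B.seqProb (adv.truncate n) a = B.seqProb adv a := by
  simp only [seqProb, vec_truncate adv h]

theorem swapRegret_snoc_zero {n : ℕ} (a : Fin n → Fin N) (k : Fin N) (b : Fin n → Fin N → ℝ) :
    swapRegret (Fin.snoc a k : Fin (n + 1) → Fin N) (Fin.snoc b (fun _ => 0)) =
      swapRegret a b := by
  simp [swapRegret, Fin.sum_univ_castSucc]

/-- The expected swap regret of a run is at least that of each of its prefixes. -/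
theorem sum_seqProb_mul_swapRegret_le (B : BanditAlgorithm N) {L : ℕ} (hL : 0 < L) {ε : ℝ}
    (hB : ∀ adv : Adversary N, B.expAvgSwapRegret adv L ≤ ε) (adv : Adversary N) {n : ℕ}
    (hn : n ≤ L) : ∑ a : Fin n → Fin N, B.seqProb adv a * swapRegret a (adv.vec a) ≤ L * ε := by
  -- Rounds without rewards leave the swap regret unchanged, and their action probabilities sum to
  -- one. The regret bound for all `L` rounds against the truncated adversary thus covers the first
  -- `n`.
  have key : ∀ m, n ≤ m → ∑ a : Fin m → Fin N, B.seqProb (adv.truncate n) a *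
      swapRegret a ((adv.truncate n).vec a) =
      ∑ a : Fin n → Fin N, B.seqProb adv a * swapRegret a (adv.vec a) := by
    intro m hm
    induction m, hm using Nat.le_induction with
    | base => simp only [vec_truncate adv le_rfl, seqProb_truncate B adv le_rfl]
    | succ m hm ih =>
      rw [← ih, sum_snoc]
      refine Finset.sum_congr rfl fun a _ => ?_
      have hz : (adv.truncate n).reward m a = fun _ => 0 := by
        funext k
        exact if_neg (not_lt.2 hm)
      simp only [Adversary.vec_snoc, hz, swapRegret_snoc_zero, seqProb_snoc]
      rw [← Finset.sum_mul, ← Finset.mul_sum, B.prob_sum, mul_one]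
  have h := hB (adv.truncate n)
  rw [expAvgSwapRegret, div_le_iff₀ (by exact_mod_cast hL), key L hn] at h
  linarith

end BanditAlgorithm

/-! ### Replacing the opponents by a deterministic adversary -/

namespace StochasticRewardGame

variable {M N : ℕ} {Θ : Type*} [MeasurableSpace Θ] {x : StochasticRewardGame M N Θ}

/-- After one round the players continue with different shifts of their algorithms, which is why the
density allows one algorithm per player. -/
theorem playDensity_cons (B : Fin M → BanditAlgorithm N) {n : ℕ} (a : Fin n → Fin M → Fin N)
    (p : Fin M → Fin N) (θ : Fin n → Θ) (θ' : Θ) :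
    x.playDensity B (Fin.cons p a : Fin (n + 1) → Fin M → Fin N) (Fin.cons θ' θ) =
      (∏ i, (B i).prob 0 Fin.elim0 (p i)) *
        x.playDensity (fun i => (B i).shift (p i, x.u p θ' i)) a θ := by
  simp only [playDensity, Fin.prod_univ_succ, observed_cons, before_cons_succ, Fin.cons_succ,
    Fin.cons_zero]
  congr 1
  refine Finset.prod_congr rfl fun i _ => ?_
  exact congrFun ((B i).prob_zero_eq _ _) _

/-- Drawing the coordinate `i` of a product distribution again does not change expectations. -/
theorem sum_prod_mul_eq_sum_update {ι κ : Type*} [Fintype ι] [DecidableEq ι] [Fintype κ]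
    (w : ι → κ → ℝ) (i : ι) (hw : ∑ k, w i k = 1) (H : (ι → κ) → ℝ) :
    ∑ p : ι → κ, (∏ j, w j (p j)) * H p =
      ∑ p : ι → κ, (∏ j, w j (p j)) * ∑ k, w i k * H (Function.update p i k) := by
  have hprod (p : ι → κ) (k : κ) : (∏ j, w j (Function.update p i k j)) * w i (p i) =
      (∏ j, w j (p j)) * w i k := by
    rw [← Finset.mul_prod_erase Finset.univ _ (Finset.mem_univ i),
      ← Finset.mul_prod_erase Finset.univ (fun j => w j (p j)) (Finset.mem_univ i),
      Function.update_self]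
    have : ∏ j ∈ Finset.univ.erase i, w j (Function.update p i k j) =
        ∏ j ∈ Finset.univ.erase i, w j (p j) :=
      Finset.prod_congr rfl fun j hj => by rw [Function.update_of_ne (Finset.ne_of_mem_erase hj)]
    rw [this]
    ring
  -- Exchanging coordinate `i` with an independent copy is an involution that preserves the weights.
  have hinv : Function.Involutive fun q : (ι → κ) × κ => (Function.update q.1 i q.2, q.1 i) := by
    rintro ⟨p, k⟩
    simp
  calc ∑ p : ι → κ, (∏ j, w j (p j)) * H p
      = ∑ q : (ι → κ) × κ, (∏ j, w j (q.1 j)) * w i q.2 * H q.1 := by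
        rw [Fintype.sum_prod_type]
        refine Finset.sum_congr rfl fun p _ => ?_
        change _ = ∑ k, (∏ j, w j (p j)) * w i k * H p
        rw [← Finset.sum_mul, ← Finset.mul_sum, hw, mul_one]
    _ = ∑ q : (ι → κ) × κ, (∏ j, w j (q.1 j)) * w i q.2 * H (Function.update q.1 i q.2) := by
        rw [← Equiv.sum_comp hinv.toPerm]
        refine Finset.sum_congr rfl fun q _ => ?_
        exact congrArg (· * H (Function.update q.1 i q.2)) (hprod q.1 q.2)
    _ = _ := by
        rw [Fintype.sum_prod_type]
        refine Finset.sum_congr rfl fun p _ => ?_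
        rw [Finset.mul_sum]
        exact Finset.sum_congr rfl fun k _ => mul_assoc _ _ _

/-- Given the reward tensors, the expectation of a functional of the actions of player `i` and of
the reward vectors that the other players induce is at most its expectation against some
(deterministic) adversary. -/
theorem exists_adversary_sum_playDensity_le (x : StochasticRewardGame M N Θ) (i : Fin M) {T : ℕ}
    (B : Fin M → BanditAlgorithm N) (θ : Fin T → Θ)
    (G : (Fin T → Fin N) → (Fin T → Fin N → ℝ) → ℝ) :
    ∃ adv : Adversary N, ∑ a : Fin T → Fin M → Fin N, x.playDensity B a θ *
        G (fun t => a t i) (fun t k => x.u (Function.update (a t) i k) (θ t) i) ≤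
      ∑ a : Fin T → Fin N, (B i).seqProb adv a * G a (adv.vec a) := by
  induction T generalizing B with
  | zero =>
    refine ⟨Adversary.zero N, le_of_eq ?_⟩
    simp only [Fintype.sum_unique, playDensity, BanditAlgorithm.seqProb, Finset.univ_eq_empty,
      Finset.prod_empty]
    congr 2 <;> exact Subsingleton.elim _ _
  | succ n ih =>
    let w : Fin M → Fin N → ℝ := fun j k => (B j).prob 0 Fin.elim0 k
    let vec : (Fin M → Fin N) → Fin N → ℝ := fun p k => x.u (Function.update p i k) (θ 0) i
    choose adv hadv using fun p : Fin M → Fin N => ih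
      (fun j => (B j).shift (p j, x.u p (θ 0) j)) (Fin.tail θ)
      (fun a b => G (Fin.cons (p i) a) (Fin.cons (vec p) b))
    let V : (Fin M → Fin N) → ℝ := fun p => ∑ a : Fin n → Fin N,
      ((B i).shift (p i, x.u p (θ 0) i)).seqProb (adv p) a *
        G (Fin.cons (p i) a) (Fin.cons (vec p) ((adv p).vec a))
    -- Averaging over the action of player `i` leaves a function of the other players' actions only.
    -- A maximizer `c` then fixes a first reward vector that does not anticipate the action of
    -- player `i`, while the continuation may depend on it.
    let W : (Fin M → Fin N) → ℝ := fun p => ∑ k, w i k * V (Function.update p i k)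
    have hw1 : ∑ p : Fin M → Fin N, ∏ j, w j (p j) = 1 := sum_prod_prob B fun _ => Fin.elim0
    -- For `N = 0` there might be no profile; weights with sum one exclude this.
    have hne : Nonempty (Fin M → Fin N) := by
      by_contra h
      rw [not_nonempty_iff] at h
      simp at hw1
    obtain ⟨c, hc⟩ := Finite.exists_max W
    refine ⟨Adversary.cons (vec c) (fun k => x.u_mem _ _ _) fun k => adv (Function.update c i k), ?_⟩
    calc ∑ a : Fin (n + 1) → Fin M → Fin N, x.playDensity B a θ *
          G (fun t => a t i) (fun t k => x.u (Function.update (a t) i k) (θ t) i)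
        = ∑ p : Fin M → Fin N, (∏ j, w j (p j)) * ∑ a : Fin n → Fin M → Fin N,
            x.playDensity (fun j => (B j).shift (p j, x.u p (θ 0) j)) a (Fin.tail θ) *
            G (Fin.cons (p i) (fun t => a t i)) (Fin.cons (vec p)
              (fun t k => x.u (Function.update (a t) i k) (Fin.tail θ t) i)) := by
          rw [sum_cons]
          refine Finset.sum_congr rfl fun p _ => ?_
          rw [Finset.mul_sum]
          refine Finset.sum_congr rfl fun a _ => ?_
          rw [← mul_assoc, ← playDensity_cons, Fin.cons_self_tail]
          congr 2
          · funext t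
            refine Fin.cases ?_ (fun t => ?_) t <;> simp
          · funext t
            refine Fin.cases ?_ (fun t => ?_) t <;> simp [vec, Fin.tail]
      _ ≤ ∑ p : Fin M → Fin N, (∏ j, w j (p j)) * V p :=
          Finset.sum_le_sum fun p _ => mul_le_mul_of_nonneg_left (hadv p)
            (Finset.prod_nonneg fun j _ => (B j).prob_nonneg _ _ _)
      _ = ∑ p : Fin M → Fin N, (∏ j, w j (p j)) * W p :=
          sum_prod_mul_eq_sum_update w i ((B i).prob_sum _ _) V
      _ ≤ ∑ p : Fin M → Fin N, (∏ j, w j (p j)) * W c :=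
          Finset.sum_le_sum fun p _ => mul_le_mul_of_nonneg_left (hc p)
            (Finset.prod_nonneg fun j _ => (B j).prob_nonneg _ _ _)
      _ = W c := by rw [← Finset.sum_mul, hw1, one_mul]
      _ = _ := by
          rw [sum_cons]
          refine Finset.sum_congr rfl fun k _ => ?_
          rw [Finset.mul_sum]
          refine Finset.sum_congr rfl fun a _ => ?_
          rw [BanditAlgorithm.seqProb_cons, Adversary.vec_cons]
          simp [vec, w, mul_assoc]

end StochasticRewardGame

/-! ### Hoeffding's lemma, Chernoff's bound and expected maxima -/

section Concentration

open ProbabilityTheory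

variable {Ω : Type*} [MeasurableSpace Ω] {μ : Measure Ω} [IsProbabilityMeasure μ] {Z : Ω → ℝ}

theorem integrable_of_mem_Icc (hZ : Measurable Z) {c d : ℝ} (h : ∀ ω, Z ω ∈ Set.Icc c d) :
    Integrable Z μ :=
  Integrable.of_mem_Icc c d hZ.aemeasurable (Filter.Eventually.of_forall h)

theorem integrable_exp_mul_of_mem_Icc' (hZ : Measurable Z) {c d : ℝ}
    (h : ∀ ω, Z ω ∈ Set.Icc c d) (l : ℝ) : Integrable (fun ω => Real.exp (l * Z ω)) μ := by
  refine Integrable.of_bound (Real.measurable_exp.comp (hZ.const_mul l)).aestronglyMeasurable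
    (Real.exp (|l| * max |c| |d|)) (Filter.Eventually.of_forall fun ω => ?_)
  rw [Real.norm_eq_abs, Real.abs_exp, Real.exp_le_exp]
  refine (le_abs_self _).trans ?_
  rw [abs_mul]
  exact mul_le_mul_of_nonneg_left (abs_le_max_abs_abs (h ω).1 (h ω).2) (abs_nonneg _)

/-- Hoeffding's lemma for the centred variable, with the mean restored as a factor. -/
theorem mgf_le_exp_of_mem_Icc (hZ : Measurable Z) {c d : ℝ}
    (h : ∀ ω, Z ω ∈ Set.Icc c (c + d)) (l : ℝ) :
    mgf Z μ l ≤ Real.exp (l * ∫ ω, Z ω ∂μ + d ^ 2 * l ^ 2 / 8) := by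
  have h1 := (hasSubgaussianMGF_of_mem_Icc (μ := μ) hZ.aemeasurable
    (Filter.Eventually.of_forall h)).mgf_le l
  have h2 : mgf Z μ l = Real.exp (l * ∫ ω, Z ω ∂μ) *
      mgf (fun ω => Z ω - ∫ ω, Z ω ∂μ) μ l := by
    simp only [mgf]
    rw [← integral_const_mul]
    congr 1
    funext ω
    rw [← Real.exp_add]
    congr 1
    ring
  rw [h2, Real.exp_add]
  refine mul_le_mul_of_nonneg_left (h1.trans (le_of_eq ?_)) (Real.exp_pos _).le
  congr 1
  simp only [add_sub_cancel_left, NNReal.coe_pow, NNReal.coe_div, coe_nnnorm, Real.norm_eq_abs,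
    div_pow, sq_abs]
  norm_num
  ring

theorem measureReal_ge_le_of_mgf_le {c d e s : ℝ} (hZ : Measurable Z)
    (h : ∀ ω, Z ω ∈ Set.Icc c d) {v : ℝ} (hv : 0 < v) (hs : 0 ≤ s)
    (hmgf : ∀ l, 0 ≤ l → mgf Z μ l ≤ Real.exp (l * e + v * l ^ 2 / 8)) :
    μ.real {ω | e + s ≤ Z ω} ≤ Real.exp (-(2 * s ^ 2 / v)) := by
  -- The value `4 * s / v` minimizes the Chernoff exponent `-l * s + v * l ^ 2 / 8`.
  have hl : 0 ≤ 4 * s / v := by positivity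
  refine (measure_ge_le_exp_mul_mgf (e + s) hl (integrable_exp_mul_of_mem_Icc' hZ h _)).trans ?_
  refine (mul_le_mul_of_nonneg_left (hmgf _ hl) (Real.exp_pos _).le).trans (le_of_eq ?_)
  rw [← Real.exp_add]
  congr 1
  field_simp
  ring

/-- A bound for the expected maximum of finitely many random variables with bounded moment
generating functions. -/
theorem integral_le_of_exp_le_sum {ι : Type*} [Fintype ι] {c d : ℝ} (hZ : Measurable Z)
    (h : ∀ ω, Z ω ∈ Set.Icc c d) {X : ι → Ω → ℝ} {l v : ℝ} (hl : 0 < l)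
    (hX : ∀ i, Integrable (fun ω => Real.exp (l * X i ω)) μ)
    (hmgf : ∀ i, mgf (X i) μ l ≤ Real.exp v) (hmax : ∀ ω, ∃ i, Z ω = X i ω) :
    ∫ ω, Z ω ∂μ ≤ (Real.log (Fintype.card ι) + v) / l := by
  obtain ⟨ω₀⟩ : Nonempty Ω := by
    by_contra hne
    rw [not_nonempty_iff] at hne
    have h1 := measure_univ (μ := μ)
    rw [Set.univ_eq_empty_iff.2 hne, measure_empty] at h1
    exact zero_ne_one h1
  obtain ⟨i₀, -⟩ := hmax ω₀
  have hcard : (0 : ℝ) < Fintype.card ι := by exact_mod_cast Fintype.card_pos_iff.2 ⟨i₀⟩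
  -- Jensen's inequality, then the maximum of the exponentials is at most their sum.
  have h1 : Real.exp (l * ∫ ω, Z ω ∂μ) ≤ Fintype.card ι * Real.exp v := by
    calc Real.exp (l * ∫ ω, Z ω ∂μ)
        = Real.exp (∫ ω, l * Z ω ∂μ) := by rw [integral_const_mul]
      _ ≤ ∫ ω, Real.exp (l * Z ω) ∂μ :=
          convexOn_exp.map_integral_le Real.continuous_exp.continuousOn isClosed_univ
            (by simp) ((integrable_of_mem_Icc hZ h).const_mul l)
            (integrable_exp_mul_of_mem_Icc' hZ h l)
      _ ≤ ∫ ω, ∑ i, Real.exp (l * X i ω) ∂μ := by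
          refine integral_mono (integrable_exp_mul_of_mem_Icc' hZ h l)
            (integrable_finsetSum _ fun i _ => hX i) fun ω => ?_
          obtain ⟨i, hi⟩ := hmax ω
          change Real.exp (l * Z ω) ≤ _
          rw [hi]
          exact Finset.single_le_sum (f := fun i => Real.exp (l * X i ω))
            (fun j _ => (Real.exp_pos _).le) (Finset.mem_univ i)
      _ = ∑ i, mgf (X i) μ l := integral_finsetSum _ fun i _ => hX i
      _ ≤ ∑ _i : ι, Real.exp v := Finset.sum_le_sum fun i _ => hmgf i
      _ = _ := by simp
  rw [le_div_iff₀ hl, mul_comm, ← Real.exp_le_exp]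
  rwa [Real.exp_add, Real.exp_log hcard]

end Concentration

/-! ### Moment generating functions along a play -/

namespace StochasticRewardGame

open ProbabilityTheory

variable {M N : ℕ} {Θ : Type*}

/-- The sum over all rounds of a function of the profile and the reward tensor. -/
def playSum (X : (Fin M → Fin N) → Θ → ℝ) {T : ℕ}
    (ω : (Fin T → Fin M → Fin N) × (Fin T → Θ)) : ℝ :=
  ∑ t, X (ω.1 t) (ω.2 t)

theorem playSum_mem_Icc {X : (Fin M → Fin N) → Θ → ℝ} {c d : ℝ}
    (hX : ∀ p θ, X p θ ∈ Set.Icc c d) {T : ℕ} (ω : (Fin T → Fin M → Fin N) × (Fin T → Θ)) :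
    playSum X ω ∈ Set.Icc (T * c) (T * d) := by
  constructor
  · simpa [playSum] using Finset.card_nsmul_le_sum Finset.univ (fun t => X (ω.1 t) (ω.2 t)) c
      fun t _ => (hX _ _).1
  · simpa [playSum] using Finset.sum_le_card_nsmul Finset.univ (fun t => X (ω.1 t) (ω.2 t)) d
      fun t _ => (hX _ _).2

theorem playSum_append (X : (Fin M → Fin N) → Θ → ℝ) {m n : ℕ}
    (p : ((Fin m → Fin M → Fin N) × (Fin m → Θ)) × ((Fin n → Fin M → Fin N) × (Fin n → Θ))) :
    playSum X (appendPlay p) = playSum X p.1 + playSum X p.2 := by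
  simp [playSum, appendPlay, Fin.sum_univ_add]

variable [MeasurableSpace Θ]

theorem measurable_playSum {X : (Fin M → Fin N) → Θ → ℝ} (hX : ∀ p, Measurable (X p)) (T : ℕ) :
    Measurable (playSum X (T := T)) :=
  measurable_from_prod_countable_right fun _ => Finset.measurable_sum _ fun t _ =>
    (hX _).comp (measurable_pi_apply t)

/-- The moment generating function of a sum of martingale differences. -/
theorem mgf_playSum_le (x : StochasticRewardGame M N Θ) (B : BanditAlgorithm N)
    {X : (Fin M → Fin N) → Θ → ℝ} (hX : ∀ p, Measurable (X p)) {d : ℝ}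
    (hd : ∀ p, ∃ c, ∀ θ, X p θ ∈ Set.Icc c (c + d)) (hX0 : ∀ p, ∫ θ, X p θ ∂x.r = 0)
    (T : ℕ) (l : ℝ) :
    mgf (playSum X) (x.playLaw B T) l ≤ Real.exp (T * (d ^ 2 * l ^ 2 / 8)) := by
  have hm (n : ℕ) : Measurable fun ω : (Fin n → Fin M → Fin N) × (Fin n → Θ) =>
      ENNReal.ofReal (Real.exp (l * playSum X ω)) :=
    (Real.measurable_exp.comp ((measurable_playSum hX n).const_mul l)).ennreal_ofReal
  have key (n : ℕ) : ∫⁻ ω, ENNReal.ofReal (Real.exp (l * playSum X ω)) ∂x.playLaw B n ≤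
      ENNReal.ofReal (Real.exp (n * (d ^ 2 * l ^ 2 / 8))) := by
    induction n with
    | zero => simp [playSum]
    | succ n ih =>
      rw [lintegral_playLaw_snoc x B (hm (n + 1))]
      -- Given the past and the new profile `p`, the increment has mean zero and range `d`, so
      -- Hoeffding's lemma applies to the new tensor alone.
      have hstep (ω : (Fin n → Fin M → Fin N) × (Fin n → Θ)) (p : Fin M → Fin N) :
          ∫⁻ θ', ENNReal.ofReal (Real.exp (l * playSum X
            ((Fin.snoc ω.1 p, Fin.snoc ω.2 θ') :
              (Fin (n + 1) → Fin M → Fin N) × (Fin (n + 1) → Θ)))) ∂x.r ≤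
          ENNReal.ofReal (Real.exp (l * playSum X ω)) *
            ENNReal.ofReal (Real.exp (d ^ 2 * l ^ 2 / 8)) := by
        obtain ⟨c, hc⟩ := hd p
        have h1 := mgf_le_exp_of_mem_Icc (μ := x.r) (hX p) hc l
        rw [hX0, mul_zero, zero_add] at h1
        have h2 : ∫⁻ θ', ENNReal.ofReal (Real.exp (l * X p θ')) ∂x.r ≤
            ENNReal.ofReal (Real.exp (d ^ 2 * l ^ 2 / 8)) := by
          rw [← ofReal_integral_eq_lintegral_ofReal
            (integrable_exp_mul_of_mem_Icc' (hX p) hc l)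
            (Filter.Eventually.of_forall fun _ => (Real.exp_pos _).le)]
          exact ENNReal.ofReal_le_ofReal h1
        refine le_trans (le_of_eq ?_) (mul_le_mul_right h2 _)
        refine Eq.trans ?_ (lintegral_const_mul _
          (Real.measurable_exp.comp ((hX p).const_mul l)).ennreal_ofReal)
        refine lintegral_congr fun θ' => ?_
        rw [← ENNReal.ofReal_mul (Real.exp_pos _).le, ← Real.exp_add, ← mul_add]
        simp [playSum, Fin.sum_univ_castSucc]
      calc _ ≤ ∫⁻ ω, ENNReal.ofReal (Real.exp (l * playSum X ω)) *
              ENNReal.ofReal (Real.exp (d ^ 2 * l ^ 2 / 8)) ∂x.playLaw B n := by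
            refine lintegral_mono fun ω => ?_
            refine (Finset.sum_le_sum fun p _ => mul_le_mul_right (hstep ω p) _).trans ?_
            rw [← Finset.sum_mul, ← ENNReal.ofReal_sum_of_nonneg
              fun p _ => Finset.prod_nonneg fun i _ => B.prob_nonneg _ _ _,
              sum_prod_prob (fun _ => B) (fun i => x.observed ω.1 ω.2 i), ENNReal.ofReal_one,
              one_mul]
        _ ≤ ENNReal.ofReal (Real.exp (n * (d ^ 2 * l ^ 2 / 8))) *
              ENNReal.ofReal (Real.exp (d ^ 2 * l ^ 2 / 8)) := by
            rw [lintegral_mul_const _ (hm n)]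
            exact mul_le_mul_left ih _
        _ = _ := by
            rw [← ENNReal.ofReal_mul (Real.exp_pos _).le, ← Real.exp_add]
            congr 2
            push_cast
            ring
  rw [mgf, integral_eq_lintegral_of_nonneg_ae
    (Filter.Eventually.of_forall fun _ => (Real.exp_pos _).le)
    (Real.measurable_exp.comp ((measurable_playSum hX T).const_mul l)).aestronglyMeasurable]
  exact ENNReal.toReal_le_of_le_ofReal (Real.exp_pos _).le (key T)

/-- The moment generating function of a functional that is subadditive over the blocks of play
between restarts. -/
theorem mgf_restart_le (x : StochasticRewardGame M N Θ) (B : BanditAlgorithm N) {L : ℕ}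
    (hL : 0 < L) {Z : ∀ n : ℕ, (Fin n → Fin M → Fin N) × (Fin n → Θ) → ℝ}
    (hZ : ∀ n, Measurable (Z n)) (hZc : ∀ n : ℕ, ∃ c : ℝ, ∀ ω, Z n ω ∈ Set.Icc c (c + n))
    (hZadd : ∀ n p, Z (L + n) (appendPlay p) ≤ Z L p.1 + Z n p.2) {e : ℕ → ℝ}
    (he : ∀ n ≤ L, ∫ ω, Z n ω ∂x.playLaw B n ≤ e n) (headd : ∀ n, e L + e n ≤ e (L + n))
    (T : ℕ) {l : ℝ} (hl : 0 ≤ l) :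
    mgf (Z T) (x.playLaw (B.restart L) T) l ≤ Real.exp (l * e T + L * T * l ^ 2 / 8) := by
  induction T using Nat.strong_induction_on with
  | _ T ih =>
  have hblock (n : ℕ) (hn : n ≤ L) :
      mgf (Z n) (x.playLaw B n) l ≤ Real.exp (l * e n + L * n * l ^ 2 / 8) := by
    obtain ⟨c, hc⟩ := hZc n
    refine (mgf_le_exp_of_mem_Icc (hZ n) hc l).trans (Real.exp_le_exp.2 ?_)
    -- This turns the quadratic cost of a block into one linear in its length, which adds up to `L *
    -- T` over the blocks, including an incomplete last one.
    have h1 : (n : ℝ) ^ 2 ≤ L * n := by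
      rw [sq]
      exact mul_le_mul_of_nonneg_right (by exact_mod_cast hn) (Nat.cast_nonneg n)
    have h2 := mul_le_mul_of_nonneg_left (he n hn) hl
    have h3 := mul_le_mul_of_nonneg_right h1 (sq_nonneg l)
    linarith
  rcases le_or_gt T L with hT | hT
  · rw [playLaw_restart_of_le x B hT]
    exact hblock T hT
  obtain ⟨n, rfl⟩ := Nat.exists_eq_add_of_le hT.le
  have hexp (k : ℕ) (μ : Measure ((Fin k → Fin M → Fin N) × (Fin k → Θ)))
      [IsProbabilityMeasure μ] : Integrable (fun ω => Real.exp (l * Z k ω)) μ := by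
    obtain ⟨c, hc⟩ := hZc k
    exact integrable_exp_mul_of_mem_Icc' (hZ k) hc l
  have hmp := measurePreserving_appendPlay x B L n
  calc mgf (Z (L + n)) (x.playLaw (B.restart L) (L + n)) l
      = ∫ p, Real.exp (l * Z (L + n) (appendPlay p))
          ∂(x.playLaw B L).prod (x.playLaw (B.restart L) n) := by
        rw [mgf, ← hmp.map_eq, integral_map hmp.measurable.aemeasurable]
        exact (Real.measurable_exp.comp ((hZ _).const_mul l)).aestronglyMeasurable
    _ ≤ ∫ p, Real.exp (l * Z L p.1) * Real.exp (l * Z n p.2)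
          ∂(x.playLaw B L).prod (x.playLaw (B.restart L) n) := by
        refine integral_mono (hmp.integrable_comp_of_integrable (hexp (L + n) _))
          ((hexp L _).mul_prod (hexp n _)) fun p => ?_
        change Real.exp _ ≤ _
        rw [← Real.exp_add, ← mul_add]
        exact Real.exp_le_exp.2 (mul_le_mul_of_nonneg_left (hZadd n p) hl)
    _ = mgf (Z L) (x.playLaw B L) l * mgf (Z n) (x.playLaw (B.restart L) n) l :=
        integral_prod_mul (fun ω => Real.exp (l * Z L ω)) (fun ω => Real.exp (l * Z n ω))
    _ ≤ Real.exp (l * e L + L * L * l ^ 2 / 8) * Real.exp (l * e n + L * n * l ^ 2 / 8) :=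
        mul_le_mul (hblock L le_rfl) (ih n (by omega)) mgf_nonneg (Real.exp_pos _).le
    _ ≤ _ := by
        rw [← Real.exp_add, Real.exp_le_exp]
        have := mul_le_mul_of_nonneg_left (headd n) hl
        push_cast
        linarith

end StochasticRewardGame

/-! ### Swap regret, union bounds and empirical distributions -/

instance nonempty_fin_self_map (N : ℕ) : Nonempty (Fin N → Fin N) := ⟨id⟩

theorem le_swapRegret {N T : ℕ} (a : Fin T → Fin N) (b : Fin T → Fin N → ℝ)
    (f : Fin N → Fin N) : ∑ t, b t (f (a t)) - ∑ t, b t (a t) ≤ swapRegret a b :=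
  sub_le_sub_right (le_ciSup (f := fun f : Fin N → Fin N => ∑ t, b t (f (a t)))
    (Set.finite_range _).bddAbove f) _

theorem swapRegret_nonneg {N T : ℕ} (a : Fin T → Fin N) (b : Fin T → Fin N → ℝ) :
    0 ≤ swapRegret a b := by
  simpa using le_swapRegret a b id

theorem swapRegret_le {N T : ℕ} (a : Fin T → Fin N) (b : Fin T → Fin N → ℝ)
    (hb : ∀ t k, b t k ∈ Set.Icc (0 : ℝ) 1) : swapRegret a b ≤ T := by
  have h1 : (⨆ f : Fin N → Fin N, ∑ t, b t (f (a t))) ≤ T :=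
    ciSup_le fun f => by
      simpa using Finset.sum_le_card_nsmul Finset.univ (fun t => b t (f (a t))) 1
        fun t _ => (hb _ _).2
  have h2 : 0 ≤ ∑ t, b t (a t) := Finset.sum_nonneg fun t _ => (hb _ _).1
  unfold swapRegret
  linarith

/-- Only subadditivity is used, so `A` needs no measurability. -/
theorem one_sub_le_measureReal {Ω ι : Type*} [MeasurableSpace Ω] [Fintype ι] (μ : Measure Ω)
    [IsProbabilityMeasure μ] {A : Set Ω} {bad : ι → Set Ω} {q : ℝ}
    (hbad : ∀ ω, ω ∉ A → ∃ i, ω ∈ bad i) (hq : ∀ i, μ.real (bad i) ≤ q) :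
    1 - Fintype.card ι * q ≤ μ.real A := by
  have h1 : μ.real (A ∪ ⋃ i, bad i) = 1 := by
    have : A ∪ ⋃ i, bad i = Set.univ := by
      ext ω
      simp only [Set.mem_union, Set.mem_iUnion, Set.mem_univ, iff_true]
      exact or_iff_not_imp_left.2 (hbad ω)
    rw [this, probReal_univ]
  have h2 := measureReal_union_le (μ := μ) A (⋃ i, bad i)
  have h3 : μ.real (⋃ i, bad i) ≤ Fintype.card ι * q := by
    refine (measureReal_iUnion_fintype_le bad).trans ?_
    simpa using Finset.sum_le_card_nsmul Finset.univ (fun i => μ.real (bad i)) q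
      fun i _ => hq i
  linarith

theorem sum_empirical_mul {M N T : ℕ} (a : Fin T → Fin M → Fin N)
    (g : (Fin M → Fin N) → ℝ) : ∑ p, empirical a p * g p = (∑ t, g (a t)) / T := by
  have h (p : Fin M → Fin N) : empirical a p * g p =
      (∑ t ∈ Finset.univ.filter fun t => a t = p, g (a t)) / T := by
    rw [Finset.sum_congr rfl (g := fun _ => g p) fun t ht => by rw [(Finset.mem_filter.1 ht).2]]
    simp only [empirical, Finset.sum_const, nsmul_eq_mul]
    ring
  rw [Finset.sum_congr rfl fun p _ => h p, ← Finset.sum_div,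
    Finset.sum_fiberwise Finset.univ a fun t => g (a t)]

theorem empirical_mem_stdSimplex {M N T : ℕ} (hT : 0 < T) (a : Fin T → Fin M → Fin N) :
    empirical a ∈ stdSimplex ℝ (Fin M → Fin N) := by
  refine ⟨fun p => div_nonneg (Nat.cast_nonneg _) (Nat.cast_nonneg _), ?_⟩
  have h := sum_empirical_mul a fun _ => 1
  have hT' : (T : ℝ) ≠ 0 := by exact_mod_cast hT.ne'
  simpa [hT'] using h

/-! ### Regret in mean utility: bounds for a single run -/

namespace StochasticRewardGame

open ProbabilityTheory

variable {M N : ℕ} {Θ : Type*} [MeasurableSpace Θ] {x : StochasticRewardGame M N Θ}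

theorem integrable_u (x : StochasticRewardGame M N Θ) (p : Fin M → Fin N) (i : Fin M) :
    Integrable (fun θ => x.u p θ i) x.r :=
  integrable_of_mem_Icc (x.u_measurable p i) fun θ => x.u_mem p θ i

theorem meanUtility_mem (x : StochasticRewardGame M N Θ) (p : Fin M → Fin N) (i : Fin M) :
    x.meanUtility p i ∈ Set.Icc (0 : ℝ) 1 := by
  refine ⟨integral_nonneg fun θ => (x.u_mem p θ i).1, ?_⟩
  have h := integral_mono (x.integrable_u p i) (integrable_const (1 : ℝ))
    fun θ => (x.u_mem p θ i).2
  simpa [meanUtility] using h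

/-- The gain in mean utility over the profiles `a` when player `i` follows the best swap function
in hindsight. -/
def meanRegret (x : StochasticRewardGame M N Θ) (i : Fin M) {T : ℕ}
    (a : Fin T → Fin M → Fin N) : ℝ :=
  ⨆ f : Fin N → Fin N,
    ∑ t, (x.meanUtility (Function.update (a t) i (f (a t i))) i - x.meanUtility (a t) i)

theorem le_meanRegret (x : StochasticRewardGame M N Θ) (i : Fin M) {T : ℕ}
    (a : Fin T → Fin M → Fin N) (f : Fin N → Fin N) :
    ∑ t, (x.meanUtility (Function.update (a t) i (f (a t i))) i - x.meanUtility (a t) i) ≤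
      x.meanRegret i a :=
  le_ciSup (f := fun f : Fin N → Fin N =>
    ∑ t, (x.meanUtility (Function.update (a t) i (f (a t i))) i - x.meanUtility (a t) i))
    (Set.finite_range _).bddAbove f

theorem meanRegret_nonneg (x : StochasticRewardGame M N Θ) (i : Fin M) {T : ℕ}
    (a : Fin T → Fin M → Fin N) : 0 ≤ x.meanRegret i a := by
  simpa using x.le_meanRegret i a id

theorem meanRegret_le (x : StochasticRewardGame M N Θ) (i : Fin M) {T : ℕ}
    (a : Fin T → Fin M → Fin N) : x.meanRegret i a ≤ T :=
  ciSup_le fun f => by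
    simpa using Finset.sum_le_card_nsmul Finset.univ (fun t =>
      x.meanUtility (Function.update (a t) i (f (a t i))) i - x.meanUtility (a t) i) 1
      fun t _ => by
        have h1 := (x.meanUtility_mem (Function.update (a t) i (f (a t i))) i).2
        have h2 := (x.meanUtility_mem (a t) i).1
        linarith

/-- A separate best swap function for each block does at least as well as a common one. -/
theorem meanRegret_append_le (x : StochasticRewardGame M N Θ) (i : Fin M) {m n : ℕ}
    (a : Fin m → Fin M → Fin N) (b : Fin n → Fin M → Fin N) :
    x.meanRegret i (Fin.append a b) ≤ x.meanRegret i a + x.meanRegret i b :=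
  ciSup_le fun f => by
    simp only [Fin.sum_univ_add, Fin.append_left, Fin.append_right]
    exact add_le_add (x.le_meanRegret i a f) (x.le_meanRegret i b f)

theorem measurable_meanRegret (x : StochasticRewardGame M N Θ) (i : Fin M) (T : ℕ) :
    Measurable fun ω : (Fin T → Fin M → Fin N) × (Fin T → Θ) => x.meanRegret i ω.1 :=
  (measurable_of_countable (x.meanRegret i (T := T))).comp measurable_fst

theorem isApproxCE_empirical (x : StochasticRewardGame M N Θ) {T : ℕ} (hT : 0 < T)
    (a : Fin T → Fin M → Fin N) {c : ℝ} (h : ∀ i, x.meanRegret i a ≤ T * c) :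
    x.IsApproxCE c (empirical a) := by
  refine ⟨empirical_mem_stdSimplex hT a, fun i f => ?_⟩
  have h1 := (x.le_meanRegret i a f).trans (h i)
  rw [Finset.sum_sub_distrib] at h1
  have hT' : (0 : ℝ) < T := by exact_mod_cast hT
  rw [ge_iff_le, sub_le_iff_le_add', ← sub_le_iff_le_add]
  simp only [expectedUtility, swappedUtility,
    sum_empirical_mul a fun p => x.meanUtility p i,
    sum_empirical_mul a fun p => x.meanUtility (Function.update p i (f (p i))) i]
  rw [← sub_div, div_le_iff₀ hT']
  linarith

/-- The error when the gain of player `i` from the swap function `f` is estimated by the gain for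
one reward tensor. -/
def swapDeviation (x : StochasticRewardGame M N Θ) (i : Fin M) (f : Fin N → Fin N)
    (p : Fin M → Fin N) (θ : Θ) : ℝ :=
  (x.meanUtility (Function.update p i (f (p i))) i - x.meanUtility p i) -
    (x.u (Function.update p i (f (p i))) θ i - x.u p θ i)

theorem measurable_swapDeviation (x : StochasticRewardGame M N Θ) (i : Fin M)
    (f : Fin N → Fin N) (p : Fin M → Fin N) : Measurable (x.swapDeviation i f p) :=
  measurable_const.sub ((x.u_measurable _ i).sub (x.u_measurable _ i))

/-- For a fixed profile the mean part is constant, so the width is `2` and not the `4` of the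
uniform bound; this width enters the martingale estimate. -/
theorem exists_swapDeviation_mem (x : StochasticRewardGame M N Θ) (i : Fin M)
    (f : Fin N → Fin N) (p : Fin M → Fin N) :
    ∃ c, ∀ θ, x.swapDeviation i f p θ ∈ Set.Icc c (c + 2) := by
  refine ⟨x.meanUtility (Function.update p i (f (p i))) i - x.meanUtility p i - 1, fun θ => ?_⟩
  have h1 := x.u_mem (Function.update p i (f (p i))) θ i
  have h2 := x.u_mem p θ i
  unfold swapDeviation
  constructor <;> linarith [h1.1, h1.2, h2.1, h2.2]

theorem swapDeviation_mem (x : StochasticRewardGame M N Θ) (i : Fin M)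
    (f : Fin N → Fin N) (p : Fin M → Fin N) (θ : Θ) :
    x.swapDeviation i f p θ ∈ Set.Icc (-2 : ℝ) 2 := by
  have h1 := x.u_mem (Function.update p i (f (p i))) θ i
  have h2 := x.u_mem p θ i
  have h3 := x.meanUtility_mem (Function.update p i (f (p i))) i
  have h4 := x.meanUtility_mem p i
  unfold swapDeviation
  constructor <;> linarith [h1.1, h1.2, h2.1, h2.2, h3.1, h3.2, h4.1, h4.2]

theorem integral_swapDeviation (x : StochasticRewardGame M N Θ) (i : Fin M)
    (f : Fin N → Fin N) (p : Fin M → Fin N) : ∫ θ, x.swapDeviation i f p θ ∂x.r = 0 := by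
  have h : Integrable (fun θ => x.u (Function.update p i (f (p i))) θ i - x.u p θ i) x.r :=
    (x.integrable_u _ i).sub (x.integrable_u p i)
  simp only [swapDeviation]
  rw [integral_sub (integrable_const _) h,
    integral_sub (x.integrable_u (Function.update p i (f (p i))) i) (x.integrable_u p i)]
  simp [meanUtility]

/-- The largest total estimation error over all swap functions. -/
def maxSwapDeviation (x : StochasticRewardGame M N Θ) (i : Fin M) {T : ℕ}
    (ω : (Fin T → Fin M → Fin N) × (Fin T → Θ)) : ℝ :=
  ⨆ f : Fin N → Fin N, playSum (x.swapDeviation i f) ω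

theorem measurable_maxSwapDeviation (x : StochasticRewardGame M N Θ) (i : Fin M) (T : ℕ) :
    Measurable (x.maxSwapDeviation i (T := T)) :=
  Measurable.iSup fun f => measurable_playSum (x.measurable_swapDeviation i f) T

theorem maxSwapDeviation_mem (x : StochasticRewardGame M N Θ) (i : Fin M) {T : ℕ}
    (ω : (Fin T → Fin M → Fin N) × (Fin T → Θ)) :
    x.maxSwapDeviation i ω ∈ Set.Icc (T * (-2 : ℝ)) (T * 2) := by
  obtain ⟨f, hf⟩ := exists_eq_ciSup_of_finite (f := fun f => playSum (x.swapDeviation i f) ω)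
  rw [maxSwapDeviation, ← hf]
  exact playSum_mem_Icc (x.swapDeviation_mem i f) ω

/-- There are `N ^ N` swap functions, which gives `N * Real.log N`; increments of width `2` give `2
^ 2 / 8 = 1 / 2` per round. -/
theorem integral_maxSwapDeviation_le (x : StochasticRewardGame M N Θ) (B : BanditAlgorithm N)
    (i : Fin M) (T : ℕ) {l : ℝ} (hl : 0 < l) :
    ∫ ω, x.maxSwapDeviation i ω ∂x.playLaw B T ≤ (N * Real.log N + T * (l ^ 2 / 2)) / l := by
  have h := integral_le_of_exp_le_sum (μ := x.playLaw B T) (l := l) (v := T * (l ^ 2 / 2))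
    (x.measurable_maxSwapDeviation i T) (x.maxSwapDeviation_mem i)
    (X := fun f => playSum (x.swapDeviation i f)) hl
    (fun f => integrable_exp_mul_of_mem_Icc' (measurable_playSum (x.measurable_swapDeviation i f) T)
      (playSum_mem_Icc (x.swapDeviation_mem i f)) l)
    (fun f => by
      refine (x.mgf_playSum_le B (x.measurable_swapDeviation i f)
        (x.exists_swapDeviation_mem i f) (x.integral_swapDeviation i f) T l).trans (le_of_eq ?_)
      congr 1
      ring)
    (fun ω => by
      obtain ⟨f, hf⟩ := exists_eq_ciSup_of_finite
        (f := fun f => playSum (x.swapDeviation i f) ω)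
      exact ⟨f, hf.symm⟩)
  simpa using h

/-- The swap regret of player `i` in a play. -/
def playSwapRegret (x : StochasticRewardGame M N Θ) (i : Fin M) {T : ℕ}
    (ω : (Fin T → Fin M → Fin N) × (Fin T → Θ)) : ℝ :=
  swapRegret (fun t => ω.1 t i) fun t k => x.u (Function.update (ω.1 t) i k) (ω.2 t) i

theorem measurable_playSwapRegret (x : StochasticRewardGame M N Θ) (i : Fin M) (T : ℕ) :
    Measurable (x.playSwapRegret i (T := T)) := by
  refine measurable_from_prod_countable_right fun a => ?_
  change Measurable fun θ : Fin T → Θ => (⨆ f : Fin N → Fin N,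
    ∑ t, x.u (Function.update (a t) i (f (a t i))) (θ t) i) -
      ∑ t, x.u (Function.update (a t) i (a t i)) (θ t) i
  have h (t : Fin T) (k : Fin N) :
      Measurable fun θ : Fin T → Θ => x.u (Function.update (a t) i k) (θ t) i :=
    (x.u_measurable _ i).comp (measurable_pi_apply t)
  exact (Measurable.iSup fun f => Finset.measurable_sum _ fun t _ => h t _).sub
    (Finset.measurable_sum _ fun t _ => h t _)

theorem playSwapRegret_mem (x : StochasticRewardGame M N Θ) (i : Fin M) {T : ℕ}
    (ω : (Fin T → Fin M → Fin N) × (Fin T → Θ)) :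
    x.playSwapRegret i ω ∈ Set.Icc (0 : ℝ) T :=
  ⟨swapRegret_nonneg _ _, swapRegret_le _ _ fun _ _ => x.u_mem _ _ _⟩

theorem integral_playSwapRegret_le (x : StochasticRewardGame M N Θ) (B : BanditAlgorithm N)
    (i : Fin M) {L : ℕ} (hL : 0 < L) {ε : ℝ} (hε : 0 ≤ ε)
    (hB : ∀ adv : Adversary N, B.expAvgSwapRegret adv L ≤ ε) {n : ℕ} (hn : n ≤ L) :
    ∫ ω, x.playSwapRegret i ω ∂x.playLaw B n ≤ L * ε := by
  rw [integral_eq_lintegral_of_nonneg_ae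
    (Filter.Eventually.of_forall fun ω => (x.playSwapRegret_mem i ω).1)
    (x.measurable_playSwapRegret i n).aestronglyMeasurable]
  refine ENNReal.toReal_le_of_le_ofReal (by positivity) ?_
  rw [lintegral_playLaw x B (x.measurable_playSwapRegret i n).ennreal_ofReal]
  -- The bound holds for every fixed sequence of tensors, because the adversary may be chosen after
  -- it.
  have key (θ : Fin n → Θ) : ∑ a, ENNReal.ofReal (x.playDensity (fun _ => B) a θ) *
      ENNReal.ofReal (x.playSwapRegret i (a, θ)) ≤ ENNReal.ofReal (L * ε) := by
    obtain ⟨adv, hadv⟩ := x.exists_adversary_sum_playDensity_le i (fun _ => B) θ swapRegret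
    have h := hadv.trans (B.sum_seqProb_mul_swapRegret_le hL hB adv hn)
    refine le_trans (le_of_eq ?_) (ENNReal.ofReal_le_ofReal h)
    rw [ENNReal.ofReal_sum_of_nonneg fun a _ =>
      mul_nonneg (playDensity_nonneg _ _ _) (swapRegret_nonneg _ _)]
    exact Finset.sum_congr rfl fun a _ => (ENNReal.ofReal_mul (playDensity_nonneg _ _ _)).symm
  refine (lintegral_mono key).trans (le_of_eq ?_)
  simp

/-- For each swap function, the mean gain is the realized gain plus the deviation; maximize the two
separately. -/
theorem meanRegret_le_add (x : StochasticRewardGame M N Θ) (i : Fin M) {T : ℕ}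
    (ω : (Fin T → Fin M → Fin N) × (Fin T → Θ)) :
    x.meanRegret i ω.1 ≤ x.playSwapRegret i ω + x.maxSwapDeviation i ω :=
  ciSup_le fun f => by
    have h1 := le_swapRegret (fun t => ω.1 t i)
      (fun t k => x.u (Function.update (ω.1 t) i k) (ω.2 t) i) f
    have h2 : playSum (x.swapDeviation i f) ω ≤ x.maxSwapDeviation i ω :=
      le_ciSup (f := fun f => playSum (x.swapDeviation i f) ω) (Set.finite_range _).bddAbove f
    simp only [Function.update_eq_self, ← Finset.sum_sub_distrib] at h1
    refine le_trans (le_of_eq ?_) (add_le_add h1 h2)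
    rw [playSum, ← Finset.sum_add_distrib]
    exact Finset.sum_congr rfl fun t _ => by simp only [swapDeviation]; ring

/-- The expected regret in mean utility of a single run. -/
theorem integral_meanRegret_le (x : StochasticRewardGame M N Θ) (B : BanditAlgorithm N)
    (i : Fin M) {L : ℕ} {ε : ℝ} (hε : 0 < ε) (hL : B.IsRunLength ε L) {n : ℕ} (hn : n ≤ L) :
    ∫ ω, x.meanRegret i ω.1 ∂x.playLaw B n ≤ L * (2 * ε) := by
  have hint : Integrable (fun ω => x.meanRegret i ω.1) (x.playLaw B n) :=
    integrable_of_mem_Icc (x.measurable_meanRegret i n)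
      fun ω => ⟨x.meanRegret_nonneg i ω.1, x.meanRegret_le i ω.1⟩
  have hnL : (n : ℝ) ≤ L := by exact_mod_cast hn
  have hL0 : (0 : ℝ) < L := by exact_mod_cast hL.pos
  -- For `ε ≤ 2` the term `Real.log (2 / ε)` is nonnegative and can be dropped from the sampling
  -- condition. For larger `ε` the trivial bound `n` suffices.
  rcases le_or_gt ε 2 with h2 | h2
  · have hs := hL.sampling_le
    have hlog : 0 ≤ Real.log (2 / ε) := Real.log_nonneg ((one_le_div hε).2 h2)
    rw [div_le_iff₀ (by positivity)] at hs
    have hint1 : Integrable (x.playSwapRegret i) (x.playLaw B n) :=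
      integrable_of_mem_Icc (x.measurable_playSwapRegret i n) (x.playSwapRegret_mem i)
    have hint2 : Integrable (x.maxSwapDeviation i) (x.playLaw B n) :=
      integrable_of_mem_Icc (x.measurable_maxSwapDeviation i n) (x.maxSwapDeviation_mem i)
    have hdev : ∫ ω, x.maxSwapDeviation i ω ∂x.playLaw B n ≤ L * ε := by
      -- The choice `l = ε` balances the terms: the sampling condition gives `N * Real.log N ≤ L * ε
      -- ^ 2 / 2`, and the other term is at most the same.
      refine (x.integral_maxSwapDeviation_le B i n hε).trans ?_
      rw [div_le_iff₀ hε]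
      have := mul_le_mul_of_nonneg_right hnL (sq_nonneg ε)
      nlinarith
    calc ∫ ω, x.meanRegret i ω.1 ∂x.playLaw B n
        ≤ ∫ ω, (x.playSwapRegret i ω + x.maxSwapDeviation i ω) ∂x.playLaw B n :=
          integral_mono hint (hint1.add hint2) fun ω => x.meanRegret_le_add i ω
      _ = ∫ ω, x.playSwapRegret i ω ∂x.playLaw B n + ∫ ω, x.maxSwapDeviation i ω ∂x.playLaw B n :=
          integral_add hint1 hint2
      _ ≤ L * ε + L * ε :=
          add_le_add (x.integral_playSwapRegret_le B i hL.pos hε.le hL.regret_le hn) hdev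
      _ = _ := by ring
  · calc ∫ ω, x.meanRegret i ω.1 ∂x.playLaw B n ≤ ∫ _ω, (n : ℝ) ∂x.playLaw B n :=
          integral_mono hint (integrable_const _) fun ω => x.meanRegret_le i ω.1
      _ = n := by simp
      _ ≤ L * (2 * ε) := by nlinarith

theorem integral_playSum_append (x : StochasticRewardGame M N Θ) (B : BanditAlgorithm N)
    {X : (Fin M → Fin N) → Θ → ℝ} (hX : ∀ p, Measurable (X p)) {c d : ℝ}
    (hXc : ∀ p θ, X p θ ∈ Set.Icc c d) (L n : ℕ) :
    ∫ ω, playSum X ω ∂x.playLaw (B.restart L) (L + n) =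
      ∫ ω, playSum X ω ∂x.playLaw B L + ∫ ω, playSum X ω ∂x.playLaw (B.restart L) n := by
  have hmp := measurePreserving_appendPlay x B L n
  have h1 (k : ℕ) (μ : Measure ((Fin k → Fin M → Fin N) × (Fin k → Θ)))
      [IsProbabilityMeasure μ] : Integrable (playSum X) μ :=
    integrable_of_mem_Icc (measurable_playSum hX k) fun ω => playSum_mem_Icc hXc ω
  rw [← hmp.map_eq, integral_map hmp.measurable.aemeasurable
    (measurable_playSum hX _).aestronglyMeasurable]
  simp only [playSum_append]
  rw [integral_add ((h1 L _).comp_fst _) ((h1 n _).comp_snd _), integral_fun_fst,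
    integral_fun_snd]
  simp

theorem integral_playSum_mul (x : StochasticRewardGame M N Θ) (B : BanditAlgorithm N)
    {X : (Fin M → Fin N) → Θ → ℝ} (hX : ∀ p, Measurable (X p)) {c d : ℝ}
    (hXc : ∀ p θ, X p θ ∈ Set.Icc c d) (L K : ℕ) :
    ∫ ω, playSum X ω ∂x.playLaw (B.restart L) (L * K) = K * ∫ ω, playSum X ω ∂x.playLaw B L := by
  induction K with
  | zero => simp [playSum]
  | succ K ih =>
    rw [Nat.mul_succ, add_comm, x.integral_playSum_append B hX hXc, ih]
    push_cast
    ring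

end StochasticRewardGame

/-! ### Consequences of the lower bound on the number of rounds -/

/-- The tail bound for the number of rounds in the theorem. -/
theorem exp_neg_le_of_rounds {M L T : ℕ} {η δ : ℝ} (hM : 0 < M) (hη : 0 < η) (hδ : 0 < δ)
    (hL : 0 < L) (hT0 : 0 < T) (hT : 2 * Real.log (5 * M / δ) / η ^ 2 * L ≤ T) :
    Real.exp (-(2 * (T * (η / 2)) ^ 2 / (L * T))) ≤ δ / (5 * M) := by
  have hM' : (0 : ℝ) < M := by exact_mod_cast hM
  have hL' : (0 : ℝ) < L := by exact_mod_cast hL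
  have hT' : (0 : ℝ) < T := by exact_mod_cast hT0
  rw [← Real.le_log_iff_exp_le (by positivity)]
  have h1 : Real.log (δ / (5 * M)) = -Real.log (5 * M / δ) := by
    rw [← Real.log_inv, inv_div]
  rw [h1, neg_le_neg_iff, le_div_iff₀ (by positivity)]
  rw [div_mul_eq_mul_div, div_le_iff₀ (by positivity)] at hT
  nlinarith

/-- Since `5 * M / δ ≥ 5 > e`, the logarithm is at least `1`. -/
theorem rounds_pos {M L T : ℕ} {η δ : ℝ} (hM : 0 < M) (hη : 0 < η) (hδ : 0 < δ) (hδ1 : δ ≤ 1)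
    (hL : 0 < L) (hT : 2 * Real.log (5 * M / δ) / η ^ 2 * L ≤ T) :
    0 < T ∧ 2 * L / η ^ 2 ≤ (T : ℝ) := by
  have hM' : (1 : ℝ) ≤ M := by exact_mod_cast hM
  have hL' : (0 : ℝ) < L := by exact_mod_cast hL
  have hlog : 1 ≤ Real.log (5 * M / δ) := by
    rw [Real.le_log_iff_exp_le (by positivity), le_div_iff₀ hδ]
    have := Real.exp_one_lt_d9
    nlinarith
  have h : 2 * L / η ^ 2 ≤ (T : ℝ) := by
    refine le_trans ?_ hT
    rw [div_mul_eq_mul_div]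
    gcongr
    linarith
  refine ⟨?_, h⟩
  have : (0 : ℝ) < T := lt_of_lt_of_le (by positivity) h
  exact_mod_cast this

/-! ### The high-probability bounds -/

namespace StochasticRewardGame

open ProbabilityTheory

variable {M N : ℕ} {Θ : Type*} [MeasurableSpace Θ]

/-- Large regret is unlikely when the algorithm is restarted. -/
theorem measureReal_meanRegret_ge_le (x : StochasticRewardGame M N Θ) (B : BanditAlgorithm N)
    (i : Fin M) {L T : ℕ} {ε s : ℝ} (hε : 0 < ε) (hL : B.IsRunLength ε L) (hT : 0 < T)
    (hs : 0 ≤ s) :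
    (x.playLaw (B.restart L) T).real
      {ω | ((T + L - 1) / L : ℕ) * (L * (2 * ε)) + s ≤ x.meanRegret i ω.1} ≤
      Real.exp (-(2 * s ^ 2 / (L * T))) := by
  have hL0 := hL.pos
  refine measureReal_ge_le_of_mgf_le (x.measurable_meanRegret i T)
    (fun ω => ⟨x.meanRegret_nonneg i ω.1, x.meanRegret_le i ω.1⟩) (by positivity) hs
    fun l hl => ?_
  refine x.mgf_restart_le B hL0 (Z := fun n ω => x.meanRegret i ω.1)
    -- The number of blocks is rounded up, and an incomplete block is charged like a full run. Zero
    -- rounds count as zero blocks.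
    (e := fun n => ((n + L - 1) / L : ℕ) * (L * (2 * ε)))
    (x.measurable_meanRegret i)
    (fun n => ⟨0, fun ω => ⟨x.meanRegret_nonneg i ω.1, by simpa using x.meanRegret_le i ω.1⟩⟩)
    (fun n p => x.meanRegret_append_le i p.1.1 p.2.1) (fun n hn => ?_) (fun n => ?_) T hl
  · rcases Nat.eq_zero_or_pos n with rfl | hn0
    · have h0 : ∀ ω : (Fin 0 → Fin M → Fin N) × (Fin 0 → Θ), x.meanRegret i ω.1 = 0 := fun ω =>
        le_antisymm (by simpa using x.meanRegret_le i ω.1) (x.meanRegret_nonneg i ω.1)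
      simp only [h0, integral_zero]
      positivity
    · refine (x.integral_meanRegret_le B i hε hL hn).trans ?_
      have h1 : 1 ≤ (n + L - 1) / L := (Nat.one_le_div_iff hL0).2 (by omega)
      have h2 : (1 : ℝ) ≤ ((n + L - 1) / L : ℕ) := by exact_mod_cast h1
      exact le_mul_of_one_le_left (by positivity) h2
  · have h1 : (L + L - 1) / L = 1 := by
      rw [show L + L - 1 = (L - 1) + L by omega, Nat.add_div_right _ hL0,
        Nat.div_eq_of_lt (by omega)]
    have h2 : (L + n + L - 1) / L = (n + L - 1) / L + 1 := by
      rw [show L + n + L - 1 = (n + L - 1) + L by omega, Nat.add_div_right _ hL0]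
    simp only [h1, h2]
    push_cast
    exact le_of_eq (by ring)

/-- For `L ≤ T` rounding up adds less than `L`; otherwise there is at most one block, of length `L ≤
2 * T`. -/
theorem ceilDiv_mul_le_two_mul {L T : ℕ} (hL : 0 < L) (hLT : L ≤ 2 * T) :
    (T + L - 1) / L * L ≤ 2 * T := by
  rcases le_or_gt L T with h | h
  · have := Nat.div_mul_le_self (T + L - 1) L
    omega
  · have h1 : (T + L - 1) / L < 2 := (Nat.div_lt_iff_lt_mul hL).2 (by omega)
    have h2 : (T + L - 1) / L * L ≤ 1 * L := Nat.mul_le_mul_right L (by omega)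
    omega

theorem isApproxCE_with_high_probability (x : StochasticRewardGame M N Θ)
    (B : BanditAlgorithm N) {ε η q : ℝ} (hε : 0 < ε) (hη : 0 < η) {L T : ℕ}
    (hL : B.IsRunLength (ε / 8) L) (hT0 : 0 < T) (hT : 2 * L / η ^ 2 ≤ (T : ℝ))
    (hq0 : 0 ≤ q) (hq : Real.exp (-(2 * (T * (η / 2)) ^ 2 / (L * T))) ≤ q) :
    1 - M * q ≤ (x.playLaw (B.restart L) T).real
      {ω | x.IsApproxCE (ε / 2 + η / 2) (empirical ω.1)} := by
  have hT' : (0 : ℝ) < T := by exact_mod_cast hT0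
  -- If `L ≤ 2 * T`, the blocks contribute at most `2 * T * (2 * (ε / 8)) = T * (ε / 2)`. If not, `T
  -- ≥ 2 * L / η ^ 2` forces `η > 2`, and the trivial regret bound `T ≤ T * (η / 2)` makes the event
  -- certain.
  rcases le_or_gt L (2 * T) with hLT | hLT
  · have h := one_sub_le_measureReal (x.playLaw (B.restart L) T)
      (A := {ω | x.IsApproxCE (ε / 2 + η / 2) (empirical ω.1)})
      (bad := fun i : Fin M => {ω | ((T + L - 1) / L : ℕ) * (L * (2 * (ε / 8))) + T * (η / 2) ≤
        x.meanRegret i ω.1}) (q := q) (fun ω hω => ?_) (fun i => ?_)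
    · simpa using h
    · by_contra! hc
      simp only [Set.mem_ofPred_eq, not_le] at hc hω
      refine hω (x.isApproxCE_empirical hT0 _ fun i => (hc i).le.trans ?_)
      have h1 : (((T + L - 1) / L : ℕ) : ℝ) * L ≤ 2 * T := by
        exact_mod_cast ceilDiv_mul_le_two_mul hL.pos hLT
      nlinarith
    · exact (x.measureReal_meanRegret_ge_le B i (by positivity) hL hT0 (by positivity)).trans hq
  · have hall : {ω : (Fin T → Fin M → Fin N) × (Fin T → Θ) |
        x.IsApproxCE (ε / 2 + η / 2) (empirical ω.1)} = Set.univ := by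
      refine Set.eq_univ_of_forall fun ω => x.isApproxCE_empirical hT0 _ fun i => ?_
      refine (x.meanRegret_le i ω.1).trans ?_
      have h1 : 2 * (T : ℝ) < L := by exact_mod_cast hLT
      rw [div_le_iff₀ (by positivity)] at hT
      have h2 : 4 < η ^ 2 := by
        by_contra! h
        nlinarith
      have h3 : 2 ≤ η := by nlinarith
      nlinarith
    rw [hall, probReal_univ]
    have : 0 ≤ M * q := by positivity
    linarith

/-- A two-sided deviation bound for all players from one-sided moment bounds. -/
theorem one_sub_le_of_mgf_playSum_le {T : ℕ}
    (μ : Measure ((Fin T → Fin M → Fin N) × (Fin T → Θ)))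
    [IsProbabilityMeasure μ] {X : Fin M → (Fin M → Fin N) → Θ → ℝ}
    (hX : ∀ i p, Measurable (X i p)) {c d : ℝ} (hXc : ∀ i p θ, X i p θ ∈ Set.Icc c d)
    {e : Fin M → ℝ} {v s q : ℝ} (hv : 0 < v) (hs : 0 ≤ s)
    (hpos : ∀ i l, 0 ≤ l → mgf (playSum (X i)) μ l ≤ Real.exp (l * e i + v * l ^ 2 / 8))
    (hneg : ∀ i l, 0 ≤ l → mgf (fun ω => -playSum (X i) ω) μ l ≤
      Real.exp (l * -e i + v * l ^ 2 / 8))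
    (hq : Real.exp (-(2 * s ^ 2 / v)) ≤ q) :
    1 - 2 * M * q ≤ μ.real {ω | ∀ i, |e i - playSum (X i) ω| ≤ s} := by
  have h := one_sub_le_measureReal μ (A := {ω | ∀ i, |e i - playSum (X i) ω| ≤ s})
    (bad := Sum.elim (fun i : Fin M => {ω | e i + s ≤ playSum (X i) ω})
      (fun i : Fin M => {ω | -e i + s ≤ -playSum (X i) ω})) (q := q) (fun ω hω => ?_) ?_
  · rw [Fintype.card_sum, Fintype.card_fin] at h
    push_cast at h
    linarith
  · simp only [Set.mem_ofPred_eq, not_forall, not_le] at hω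
    obtain ⟨i, hi⟩ := hω
    rcases lt_abs.1 hi with h | h
    · refine ⟨Sum.inr i, ?_⟩
      simp only [Sum.elim_inr, Set.mem_ofPred_eq]
      linarith
    · refine ⟨Sum.inl i, ?_⟩
      simp only [Sum.elim_inl, Set.mem_ofPred_eq]
      linarith
  · rintro (i | i)
    · exact (measureReal_ge_le_of_mgf_le (measurable_playSum (hX i) _)
        (playSum_mem_Icc (hXc i)) hv hs (hpos i)).trans hq
    · refine (measureReal_ge_le_of_mgf_le (measurable_playSum (hX i) _).neg
        (c := -(T * d)) (d := -(T * c)) (fun ω => ?_) hv hs (hneg i)).trans hq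
      have := playSum_mem_Icc (hXc i) ω
      exact ⟨neg_le_neg this.2, neg_le_neg this.1⟩

theorem abs_div_sub_div_le {T : ℝ} (hT : 0 < T) {y z s : ℝ} (h : |y - z| ≤ T * s) :
    |y / T - z / T| ≤ s := by
  rw [← sub_div, abs_div, abs_of_pos hT, div_le_iff₀ hT]
  linarith

theorem processValue_eq (x : StochasticRewardGame M N Θ) (B : BanditAlgorithm N) (T : ℕ)
    (i : Fin M) :
    x.processValue B T i = (∫ ω, playSum (fun p θ => x.u p θ i) ω ∂x.playLaw B T) / T :=
  integral_div _ _

theorem avgUtility_near_processValue (x : StochasticRewardGame M N Θ) (B : BanditAlgorithm N)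
    {η q : ℝ} (hη : 0 < η) {L T : ℕ} (hL : 0 < L) (hT : 0 < T)
    (hq : Real.exp (-(2 * (T * (η / 2)) ^ 2 / (L * T))) ≤ q) :
    1 - 2 * M * q ≤ (x.playLaw (B.restart L) T).real
      {ω | ∀ i, |x.processValue (B.restart L) T i - x.avgUtility ω i| ≤ η / 2} := by
  have hT' : (0 : ℝ) < T := by exact_mod_cast hT
  have hm (i : Fin M) (p : Fin M → Fin N) : Measurable fun θ => x.u p θ i := x.u_measurable p i
  have hb (i : Fin M) (p : Fin M → Fin N) (θ : Θ) : x.u p θ i ∈ Set.Icc (0 : ℝ) 1 :=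
    x.u_mem p θ i
  have hb' (i : Fin M) {n : ℕ} (ω : (Fin n → Fin M → Fin N) × (Fin n → Θ)) :
      playSum (fun p θ => x.u p θ i) ω ∈ Set.Icc (0 : ℝ) n := by
    simpa using playSum_mem_Icc (hb i) ω
  refine (one_sub_le_of_mgf_playSum_le (x.playLaw (B.restart L) T)
    (X := fun i p θ => x.u p θ i) hm hb (v := L * T) (s := T * (η / 2)) (by positivity)
    (by positivity) (e := fun i => ∫ ω, playSum (fun p θ => x.u p θ i) ω
      ∂x.playLaw (B.restart L) T) (fun i l hl => ?_) (fun i l hl => ?_) hq).trans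
    (measureReal_mono fun ω hω i => ?_)
  -- With `e` the exact expectation, both additivity conditions hold with equality, so the negated
  -- sum can be treated alike.
  · refine x.mgf_restart_le B hL (Z := fun n => playSum fun p θ => x.u p θ i)
      (e := fun n => ∫ ω, playSum (fun p θ => x.u p θ i) ω ∂x.playLaw (B.restart L) n)
      (fun n => measurable_playSum (hm i) n) (fun n => ⟨0, fun ω => by simpa using hb' i ω⟩)
      (fun n p => (playSum_append _ p).le) (fun n hn => ?_) (fun n => ?_) T hl
    · rw [playLaw_restart_of_le x B hn]
    · rw [x.integral_playSum_append B (hm i) (hb i), playLaw_restart_of_le x B le_rfl]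
  · refine x.mgf_restart_le B hL (Z := fun n ω => -playSum (fun p θ => x.u p θ i) ω)
      (e := fun n => -∫ ω, playSum (fun p θ => x.u p θ i) ω ∂x.playLaw (B.restart L) n)
      (fun n => (measurable_playSum (hm i) n).neg) (fun n => ⟨-n, fun ω => ?_⟩)
      (fun n p => ?_) (fun n hn => ?_) (fun n => ?_) T hl
    · have := hb' i ω
      constructor <;> linarith [this.1, this.2]
    · rw [playSum_append, neg_add]
    · rw [playLaw_restart_of_le x B hn, integral_neg]
    · rw [x.integral_playSum_append B (hm i) (hb i), playLaw_restart_of_le x B le_rfl, neg_add]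
  · rw [processValue_eq]
    exact abs_div_sub_div_le hT' (hω i)

theorem processValue_restart_of_dvd (x : StochasticRewardGame M N Θ) (B : BanditAlgorithm N)
    {L T : ℕ} (hT : 0 < T) (hLT : L ∣ T) (i : Fin M) :
    x.processValue (B.restart L) T i = x.processValue B L i := by
  obtain ⟨K, rfl⟩ := hLT
  have hK : (K : ℝ) ≠ 0 := by
    rintro h
    rw [Nat.cast_eq_zero] at h
    simp [h] at hT
  rw [processValue_eq, processValue_eq, x.integral_playSum_mul B
    (fun p => x.u_measurable p i) (fun p θ => x.u_mem p θ i)]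
  push_cast
  rw [mul_comm (L : ℝ), mul_div_mul_left _ _ hK]

theorem avgUtility_near_expectedUtility (x : StochasticRewardGame M N Θ)
    (B : BanditAlgorithm N) {η q : ℝ} (hη : 0 < η) {L T : ℕ} (hL : 0 < L) (hT : 0 < T)
    (hq : Real.exp (-(2 * (T * (η / 2)) ^ 2 / (L * T))) ≤ q) :
    1 - 2 * M * q ≤ (x.playLaw B T).real
      {ω | ∀ i, |x.avgUtility ω i - x.expectedUtility (empirical ω.1) i| ≤ η} := by
  have hT' : (0 : ℝ) < T := by exact_mod_cast hT
  have hL' : (1 : ℝ) ≤ L := by exact_mod_cast hL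
  let X : Fin M → (Fin M → Fin N) → Θ → ℝ := fun i p θ => x.u p θ i - x.meanUtility p i
  have hm (i : Fin M) (p : Fin M → Fin N) : Measurable (X i p) :=
    (x.u_measurable p i).sub_const _
  have hb (i : Fin M) (p : Fin M → Fin N) (θ : Θ) : X i p θ ∈ Set.Icc (-1 : ℝ) 1 := by
    have h1 := x.u_mem p θ i
    have h2 := x.meanUtility_mem p i
    constructor <;> simp only [X] <;> linarith [h1.1, h1.2, h2.1, h2.2]
  have hb' (i : Fin M) (p : Fin M → Fin N) : ∃ c, ∀ θ, X i p θ ∈ Set.Icc c (c + 1) := by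
    refine ⟨-x.meanUtility p i, fun θ => ?_⟩
    have h1 := x.u_mem p θ i
    constructor <;> simp only [X] <;> linarith [h1.1, h1.2]
  have h0 (i : Fin M) (p : Fin M → Fin N) : ∫ θ, X i p θ ∂x.r = 0 := by
    simp only [X]
    rw [integral_sub (x.integrable_u p i) (integrable_const _)]
    simp [meanUtility]
  -- The martingale needs only `T` here; weakening it to `L * T` makes the common tail bound
  -- applicable.
  have hTL (l : ℝ) : (T : ℝ) * (1 ^ 2 * l ^ 2 / 8) ≤ L * T * l ^ 2 / 8 := by
    have : 0 ≤ (T : ℝ) * l ^ 2 := by positivity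
    nlinarith
  refine (one_sub_le_of_mgf_playSum_le (x.playLaw B T) hm hb (v := L * T) (s := T * (η / 2))
    (by positivity) (by positivity) (e := fun i => 0) (fun i l hl => ?_) (fun i l hl => ?_)
    hq).trans (measureReal_mono fun ω hω i => ?_)
  · refine (x.mgf_playSum_le B (hm i) (hb' i) (h0 i) T l).trans (Real.exp_le_exp.2 ?_)
    linarith [hTL l]
  · have h1 : mgf (fun ω => -playSum (X i) ω) (x.playLaw B T) l =
        mgf (playSum (X i)) (x.playLaw B T) (-l) := by
      simp only [mgf]
      congr 1
      funext ω
      congr 1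
      ring
    rw [h1]
    refine (x.mgf_playSum_le B (hm i) (hb' i) (h0 i) T (-l)).trans (Real.exp_le_exp.2 ?_)
    linarith [hTL (-l), neg_sq l]
  · have h1 := hω i
    rw [zero_sub, abs_neg] at h1
    have h2 : playSum (X i) ω = ∑ t, x.u (ω.1 t) (ω.2 t) i - ∑ t, x.meanUtility (ω.1 t) i := by
      simp only [playSum, X, Finset.sum_sub_distrib]
    rw [h2] at h1
    rw [expectedUtility, sum_empirical_mul ω.1 fun p => x.meanUtility p i]
    -- The deviation obtained is `η / 2`, stronger than required.
    exact (abs_div_sub_div_le hT' h1).trans (by linarith)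

end StochasticRewardGame

end

theorem corollary3p1 {M N : ℕ} {Θ : Type*} [MeasurableSpace Θ] (hM : 0 < M)
    (x : StochasticRewardGame M N Θ) (B : BanditAlgorithm N)
    (ε η δ : ℝ) (hε : 0 < ε) (hη : 0 < η) (hδ : 0 < δ) (hδ1 : δ ≤ 1)
    (L : ℕ) (hL : B.IsRunLength (ε / 8) L)
    (T : ℕ) (hT : 2 * Real.log (5 * M / δ) / η ^ 2 * L ≤ T) :
    (1 - δ / 5 ≤ (x.playLaw (B.restart L) T).real
      {ω | x.IsApproxCE (ε / 2 + η / 2) (empirical ω.1)}) ∧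
    (1 - 2 * δ / 5 ≤ (x.playLaw (B.restart L) T).real
      {ω | ∀ i, |x.processValue (B.restart L) T i - x.avgUtility ω i| ≤ η / 2}) ∧
    (L ∣ T → ∀ i, x.processValue (B.restart L) T i = x.processValue B L i) ∧
    (1 - 2 * δ / 5 ≤ (x.playLaw (B.restart L) T).real
      {ω | ∀ i, |x.avgUtility ω i - x.expectedUtility (empirical ω.1) i| ≤ η}) := by
  obtain ⟨hT0, hT2⟩ := rounds_pos hM hη hδ hδ1 hL.pos hT
  -- Each single tail has probability at most `δ / (5 * M)`; the equilibrium claim needs `M` of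
  -- them, each two-sided claim `2 * M`.
  have hq := exp_neg_le_of_rounds hM hη hδ hL.pos hT0 hT
  have hM' : (M : ℝ) ≠ 0 := by exact_mod_cast hM.ne'
  have h1 : (M : ℝ) * (δ / (5 * M)) = δ / 5 := by field_simp
  have h2 : 2 * (M : ℝ) * (δ / (5 * M)) = 2 * δ / 5 := by field_simp
  refine ⟨?_, ?_, fun hLT => x.processValue_restart_of_dvd B hT0 hLT, ?_⟩
  · rw [← h1]
    exact x.isApproxCE_with_high_probability B hε hη hL hT0 hT2 (by positivity) hq
  · rw [← h2]
    exact x.avgUtility_near_processValue B hη hL.pos hT0 hq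
  · rw [← h2]
    exact x.avgUtility_near_expectedUtility (B.restart L) hη hL.pos hT0 hq
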